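/- A triple $(p,q,r)$ is called admissible if either $p=q=1$ and $r\in[1,\infty]$, or $p\in(1,\infty)$ and $q,r\in[1,\infty]$ with $q\le r$. Let $\mathfrak Z=(Z,\rho,\mu)$ be a metric measure space, that is, a nonempty metric space with a nonnegative Borel measure. For Borel $f$ with values in $\mathbb C$ (or in $[0,\infty]$), $p\in[1,\infty)$ and $q\in[1,\infty]$ put $d_f(t)=\mu(\{x\in Z:|f(x)|>t\})$, $$\|f\|_{p,q}=p^{1/q}\Big(\int_0^\infty \big(t\,d_f(t)^{1/p}\big)^q\,\frac{dt}{t}\Big)^{1/q}\ \text{ if } q<\infty,\qquad \|f\|_{p,\infty}=\sup_{t>0}t\,d_f(t)^{1/p},$$ and let $L^{p,q}(\mathfrak Z)$ be the set of Borel functions $f:Z\to\mathbb C$ with $\|f\|_{p,q}<\infty$. Let $$\mathcal M_{\mathfrak Z}f(x)=\sup_{s>0}\frac1{\mu(B(x,s))}\int_{B(x,s)}|f|\,d\mu$$ be the centered Hardy--Littlewood maximal function ($B(x,s)$ is the open ball; balls of measure $0$ or $\infty$ are omitted). Let $\mathbf c(p,q,r,\mathfrak Z)\in[0,\infty]$ be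 the smallest constant $c<\infty$ such that $\|\mathcal M_{\mathfrak Z}f\|_{p,r}\le c\,\|f\|_{p,q}$ for all $f\in L^{p,q}(\mathfrak Z)$, and $\infty$ if there is no such constant. The space is nondoubling if there is no $C<\infty$ with $\mu(B(x,2s))\le C\mu(B(x,s))$ for all $x\in Z$ and $s>0$. **Theorem.** Fix an admissible triple $(p_0,q_0,r_0)$ with $q_0\in(1,\infty]$. Then there exists a nondoubling metric measure space $\mathfrak Z=(Z,\rho,\mu)$, bounded, with $\mu(Z)<\infty$ and with every ball of strictly positive measure, such that $$\mathbf c(p_0,1,r_0,\mathfrak Z)<\infty\qquad\text{and}\qquad \mathbf c(p_0,q_0,r_0,\mathfrak Z)=\infty .$$ -/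

import Mathlib

open MeasureTheory Set Metric
open scoped ENNReal NNReal

/-- The distribution function `d_f(t) = μ {x : |f x| > t}`, `t ≥ 0`. The values of `f` may lie in `ℂ`
or, for a maximal function, in `[0, ∞]`. -/
noncomputable def distribFun {X ε : Type*} [MeasurableSpace X] [ENorm ε]
    (μ : Measure X) (f : X → ε) (t : ℝ) : ℝ≥0∞ :=
  μ {x | ENNReal.ofReal t < ‖f x‖ₑ}

/-- The Lorentz quasinorm `‖f‖_{p,q}` for `p ∈ [1, ∞)` and `q ∈ [1, ∞]`, with value in `[0, ∞]`:
`p^{1/q} (∫_0^∞ (t d_f(t)^{1/p})^q dt/t)^{1/q}` if `q < ∞` and `sup_{t > 0} t d_f(t)^{1/p}` if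
`q = ∞`. -/
noncomputable def lorentzNorm {X ε : Type*} [MeasurableSpace X] [ENorm ε]
    (p : ℝ) (q : ℝ≥0∞) (μ : Measure X) (f : X → ε) : ℝ≥0∞ :=
  if q = ∞ then
    ⨆ t : ℝ, ⨆ _ : 0 < t, ENNReal.ofReal t * distribFun μ f t ^ (1 / p)
  else
    ENNReal.ofReal p ^ (1 / q.toReal) *
      (∫⁻ t : ℝ in Ioi 0, (ENNReal.ofReal t * distribFun μ f t ^ (1 / p)) ^ q.toReal
        / ENNReal.ofReal t) ^ (1 / q.toReal)

/-- The centered Hardy-Littlewood maximal function: the supremum over `s > 0` of the averages of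
`|f|` over the open balls `B(x, s)`; balls of measure `0` or `∞` are omitted. -/
noncomputable def centeredMaximal {X : Type*} [PseudoMetricSpace X] [MeasurableSpace X]
    (μ : Measure X) (f : X → ℂ) (x : X) : ℝ≥0∞ :=
  ⨆ s : ℝ, ⨆ _ : 0 < s ∧ μ (ball x s) ≠ 0 ∧ μ (ball x s) ≠ ∞,
    (∫⁻ y in ball x s, ‖f y‖ₑ ∂μ) / μ (ball x s)

/-- `C` is a constant for which the maximal operator satisfies
`‖M f‖_{p,r} ≤ C ‖f‖_{p,q}` for all `f ∈ L^{p,q}`. -/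
def LorentzMaximalBound {X : Type*} [PseudoMetricSpace X] [MeasurableSpace X]
    (p : ℝ) (q r : ℝ≥0∞) (μ : Measure X) (C : ℝ≥0) : Prop :=
  ∀ f : X → ℂ, Measurable f → lorentzNorm p q μ f < ∞ →
    lorentzNorm p r μ (centeredMaximal μ f) ≤ (C : ℝ≥0∞) * lorentzNorm p q μ f

/-- The smallest finite constant `C` such that `‖M f‖_{p,r} ≤ C ‖f‖_{p,q}` for all `f ∈ L^{p,q}`,
and `∞` if there is no such constant. -/
noncomputable def lorentzMaximalConst {X : Type*} [PseudoMetricSpace X] [MeasurableSpace X]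
    (p : ℝ) (q r : ℝ≥0∞) (μ : Measure X) : ℝ≥0∞ :=
  ⨅ C : ℝ≥0, ⨅ _ : LorentzMaximalBound p q r μ C, (C : ℝ≥0∞)

/-- Admissible triples: `p = q = 1` and `r ∈ [1, ∞]`, or `p ∈ (1, ∞)` and `1 ≤ q ≤ r ≤ ∞`. -/
def AdmissibleTriple (p : ℝ) (q r : ℝ≥0∞) : Prop :=
  (p = 1 ∧ q = 1 ∧ 1 ≤ r) ∨ (1 < p ∧ 1 ≤ q ∧ 1 ≤ r ∧ q ≤ r)

/-- The doubling condition: `μ(B(x, 2s)) ≤ C μ(B(x, s))` for all balls, with a uniform constant. -/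
def IsDoublingMeasure {X : Type*} [PseudoMetricSpace X] [MeasurableSpace X]
    (μ : Measure X) : Prop :=
  ∃ C : ℝ≥0, ∀ (x : X) (s : ℝ), 0 < s → μ (ball x (2 * s)) ≤ (C : ℝ≥0∞) * μ (ball x s)

/-! Write a = 1/p. Admissibility with q₀ > 1 forces p > 1. The space is a countable union of finite
components. Component N has inner shells l = 0, …, N with masses proportional to 2^l and an outer
part of mass m = `mass N (N + 1)`, twice that of the largest shell. Each shell is cut into L N
groups of n l ≈ 2^(l(1-a)) equal atoms. An outer point is a choice of one atom from every group, and
a ball of radius just above 3/2 around it consists of the point and the chosen atoms. All other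
balls are singletons, sets comparable in measure to a whole component, or the whole space.

The chosen atoms of shell l have total mass about 2^(la), so if f is close to its group means along
the choice, its average over the linked ball is about ∑_l 2^((l-N-1)a) times the mean of f on shell
l. This is m^(-a) times the integral of f against w = (shell mass)^(a-1). The masses of all shells
and outer parts are different powers of two, so w lies in the weak dual space, which pairs boundedly
with L^{p,1} but not with L^{p,q} for q > 1.

For q = 1 the averages over linked balls split into a mean and a deviation. The pairing
(`lintegral_mul_le_lorentzOne`, `setLIntegral_dualWeight_le`) bounds the means. Different groups are
chosen independently, so the variance of the deviation decays as L N grows. Choosing L N large makes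
the contribution of component N at most 2^(-N) times the norm of f (`lorentzOne_deviationComp_le`,
`exists_deviationRate_le`). This bounds M from L^{p,1} to itself, hence to L^{p,r}.

For q > 1, test with f = (m / shell mass)^a on the inner part of component N (`testFun`). Its
L^{p,q} norm is at most of order m^a N^(1/q), because it has N + 1 dyadic layers of comparable weak
norm. On the whole outer part M f is at least of order N, since every shell contributes equally to
the linked average. The ratio of the norms is at least of order N^(1-1/q), which is unbounded. -/

/-! ### The functional of L^{p,1} and its comparison with the other Lorentz quasinorms. -/

section LorentzOne

variable {X : Type*} [MeasurableSpace X]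

/-- The functional `∫_0^∞ μ {g > t}^{1/p} dt`, that is `‖g‖_{p,1} / p`. -/
noncomputable def lorentzOne (p : ℝ) (μ : Measure X) (g : X → ℝ≥0∞) : ℝ≥0∞ :=
  ∫⁻ t : ℝ in Ioi 0, μ {x | ENNReal.ofReal t < g x} ^ (1 / p)

theorem antitone_measure_superlevel (μ : Measure X) (g : X → ℝ≥0∞) :
    Antitone fun t : ℝ => μ {x | ENNReal.ofReal t < g x} := fun _ _ hst =>
  measure_mono fun _ hx => (ENNReal.ofReal_le_ofReal hst).trans_lt hx

theorem antitone_measure_superlevel_rpow {p : ℝ} (hp : 0 < p) (μ : Measure X) (g : X → ℝ≥0∞) :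
    Antitone fun t : ℝ => μ {x | ENNReal.ofReal t < g x} ^ (1 / p) := fun _ _ hst =>
  ENNReal.rpow_le_rpow (antitone_measure_superlevel μ g hst) (by positivity)

theorem lorentzOne_mono {p : ℝ} (hp : 0 < p) {μ : Measure X} {g h : X → ℝ≥0∞}
    (hgh : ∀ x, g x ≤ h x) : lorentzOne p μ g ≤ lorentzOne p μ h :=
  lintegral_mono fun _ => ENNReal.rpow_le_rpow
    (measure_mono fun x hx => lt_of_lt_of_le hx (hgh x)) (by positivity)

theorem lorentzNorm_one_eq {ε : Type*} [ENorm ε] (p : ℝ) (μ : Measure X) (f : X → ε) :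
    lorentzNorm p 1 μ f = ENNReal.ofReal p * lorentzOne p μ (fun x => ‖f x‖ₑ) := by
  unfold lorentzNorm lorentzOne distribFun
  rw [if_neg ENNReal.one_ne_top]
  simp only [ENNReal.toReal_one, div_one, ENNReal.rpow_one]
  congr 1
  refine setLIntegral_congr_fun measurableSet_Ioi fun t ht => ?_
  have ht' : (0 : ℝ) < t := ht
  rw [mul_comm]
  exact ENNReal.mul_div_cancel_right (by simpa using ht') ENNReal.ofReal_ne_top

/-- Weak-type bound: the integrand is antitone, so over (0, t] it is at least its value at t. -/
theorem ofReal_mul_measure_rpow_le_lorentzOne {p : ℝ} (hp : 0 < p) (μ : Measure X)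
    (g : X → ℝ≥0∞) (t : ℝ) :
    ENNReal.ofReal t * μ {x | ENNReal.ofReal t < g x} ^ (1 / p) ≤ lorentzOne p μ g := by
  calc ENNReal.ofReal t * μ {x | ENNReal.ofReal t < g x} ^ (1 / p)
      = ∫⁻ _ in Ioc 0 t, μ {x | ENNReal.ofReal t < g x} ^ (1 / p) := by
        rw [setLIntegral_const, Real.volume_Ioc, sub_zero, mul_comm]
    _ ≤ ∫⁻ s in Ioc 0 t, μ {x | ENNReal.ofReal s < g x} ^ (1 / p) :=
        setLIntegral_mono' measurableSet_Ioc fun _ hs =>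
          antitone_measure_superlevel_rpow hp μ g hs.2
    _ ≤ _ := lintegral_mono_set Ioc_subset_Ioi_self

/-- Superlevel sets are strict, so `c` is approached from below. Applied to singletons, this bounds
the size of a function at an atom. -/
theorem mul_measure_rpow_le_lorentzOne {p : ℝ} (hp : 0 < p) (μ : Measure X)
    {g : X → ℝ≥0∞} {E : Set X} {c : ℝ≥0∞} (hc : ∀ x ∈ E, c ≤ g x) :
    c * μ E ^ (1 / p) ≤ lorentzOne p μ g := by
  refine ENNReal.mul_le_of_forall_lt fun a ha b hb => ?_
  have hat : a ≠ ∞ := ha.ne_top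
  refine le_trans ?_ (ofReal_mul_measure_rpow_le_lorentzOne hp μ g a.toReal)
  rw [ENNReal.ofReal_toReal hat]
  refine mul_le_mul_right (hb.le.trans (ENNReal.rpow_le_rpow (measure_mono fun x hx => ?_)
    (by positivity))) _
  exact ha.trans_le (hc x hx)

/-- The embedding `L^{p,1} ⊆ L^{p,r}`. -/
theorem lorentzNorm_le_mul_lorentzOne {ε : Type*} [ENorm ε] {p : ℝ} (hp : 1 ≤ p) {r : ℝ≥0∞}
    (hr : 1 ≤ r) (μ : Measure X) (f : X → ε) :
    lorentzNorm p r μ f ≤ ENNReal.ofReal p * lorentzOne p μ (fun x => ‖f x‖ₑ) := by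
  have hp0 : 0 < p := by linarith
  have hp1 : 1 ≤ ENNReal.ofReal p := by simpa using hp
  set Λ := lorentzOne p μ (fun x => ‖f x‖ₑ) with hΛ
  have key : ∀ t : ℝ, ENNReal.ofReal t * distribFun μ f t ^ (1 / p) ≤ Λ := fun t =>
    ofReal_mul_measure_rpow_le_lorentzOne hp0 μ _ t
  unfold lorentzNorm
  split_ifs with h
  · refine (iSup₂_le fun t _ => key t).trans ?_
    exact le_mul_of_one_le_left zero_le hp1
  · have hq : 1 ≤ r.toReal := by
      simpa using ENNReal.toReal_mono h hr
    have hq0 : 0 < r.toReal := by linarith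
    have h1 : ENNReal.ofReal p ^ (1 / r.toReal) ≤ ENNReal.ofReal p := by
      conv_rhs => rw [← ENNReal.rpow_one (ENNReal.ofReal p)]
      exact ENNReal.rpow_le_rpow_of_exponent_le hp1 (by rw [div_le_one hq0]; exact hq)
    refine mul_le_mul' h1 ?_
    rw [one_div r.toReal, ENNReal.rpow_inv_le_iff hq0]
    calc ∫⁻ t : ℝ in Ioi 0, (ENNReal.ofReal t * distribFun μ f t ^ (1 / p)) ^ r.toReal
        / ENNReal.ofReal t
        ≤ ∫⁻ t : ℝ in Ioi 0, Λ ^ (r.toReal - 1) * distribFun μ f t ^ (1 / p) := by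
          refine setLIntegral_mono' measurableSet_Ioi fun t ht => ?_
          have ht' : (0 : ℝ) < t := ht
          have e : (ENNReal.ofReal t * distribFun μ f t ^ (1 / p)) ^ r.toReal
              = (ENNReal.ofReal t * distribFun μ f t ^ (1 / p)) ^ (r.toReal - 1)
                * (ENNReal.ofReal t * distribFun μ f t ^ (1 / p)) := by
            conv_lhs => rw [show r.toReal = (r.toReal - 1) + 1 by ring]
            rw [ENNReal.rpow_add_of_nonneg _ _ (by linarith) zero_le_one, ENNReal.rpow_one]
          rw [e, mul_div_assoc, mul_comm (ENNReal.ofReal t),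
            ENNReal.mul_div_cancel_right (by simpa using ht') ENNReal.ofReal_ne_top]
          rw [mul_comm (distribFun μ f t ^ (1 / p))]
          exact mul_le_mul_left (ENNReal.rpow_le_rpow (key t) (by linarith)) _
      _ = Λ ^ (r.toReal - 1) * Λ := by
          exact lintegral_const_mul _ (antitone_measure_superlevel_rpow hp0 μ _).measurable
      _ = Λ ^ r.toReal := by
          conv_rhs => rw [show r.toReal = (r.toReal - 1) + 1 by ring]
          rw [ENNReal.rpow_add_of_nonneg _ _ (by linarith) zero_le_one, ENNReal.rpow_one]

/-- Only the levels t in (c/2, c) are used. The wasteful factor 1/4 makes one bound serve every r.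
-/
theorem le_lorentzNorm_of_le {ε : Type*} [ENorm ε] {p : ℝ} (hp : 1 ≤ p) {r : ℝ≥0∞}
    (hr : 1 ≤ r) (μ : Measure X) {f : X → ε} {E : Set X} {c : ℝ} (hc : 0 < c)
    (hE : ∀ x ∈ E, ENNReal.ofReal c ≤ ‖f x‖ₑ) :
    ENNReal.ofReal (c / 4) * μ E ^ (1 / p) ≤ lorentzNorm p r μ f := by
  have hp1 : 1 ≤ ENNReal.ofReal p := by simpa using hp
  have hsub : ∀ t : ℝ, t < c → μ E ^ (1 / p) ≤ distribFun μ f t ^ (1 / p) := fun t ht =>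
    ENNReal.rpow_le_rpow (measure_mono fun x hx =>
      ((ENNReal.ofReal_lt_ofReal_iff hc).2 ht).trans_le (hE x hx)) (by positivity)
  unfold lorentzNorm
  split_ifs with h
  · refine le_trans ?_ (le_iSup₂_of_le (c / 4) (by positivity) le_rfl)
    exact mul_le_mul_right (hsub _ (by linarith)) _
  · have hq : 1 ≤ r.toReal := by
      simpa using ENNReal.toReal_mono h hr
    have hq0 : 0 < r.toReal := by linarith
    refine le_trans ?_ (le_mul_of_one_le_left zero_le (ENNReal.one_le_rpow hp1 (by positivity)))
    rw [one_div r.toReal, ENNReal.le_rpow_inv_iff hq0]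
    set m := μ E ^ (1 / p)
    -- One half of c/4 = (c/2)(1/2) raised to the power r ≥ 1 is at most 1/2, which is the length of
    -- (c/2, c) divided by c.
    calc (ENNReal.ofReal (c / 4) * m) ^ r.toReal
        ≤ (ENNReal.ofReal (c / 2) * m) ^ r.toReal * ENNReal.ofReal (1 / 2) := by
          rw [show c / 4 = c / 2 * (1 / 2) by ring, ENNReal.ofReal_mul (by positivity),
            mul_right_comm, ENNReal.mul_rpow_of_nonneg _ _ hq0.le]
          refine mul_le_mul_right ?_ _
          conv_rhs => rw [← ENNReal.rpow_one (ENNReal.ofReal (1 / 2))]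
          exact ENNReal.rpow_le_rpow_of_exponent_ge (by simp) hq
      _ = ∫⁻ t in Ioo (c / 2) c, (ENNReal.ofReal (c / 2) * m) ^ r.toReal / ENNReal.ofReal c := by
          rw [setLIntegral_const, Real.volume_Ioo, ENNReal.div_eq_inv_mul, mul_right_comm,
            mul_comm _ ((ENNReal.ofReal (c / 2) * m) ^ r.toReal), ← ENNReal.ofReal_inv_of_pos hc,
            ← ENNReal.ofReal_mul (by positivity)]
          congr 2
          field_simp
          ring
      _ ≤ ∫⁻ t in Ioo (c / 2) c,
            (ENNReal.ofReal t * distribFun μ f t ^ (1 / p)) ^ r.toReal / ENNReal.ofReal t := by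
          refine setLIntegral_mono' measurableSet_Ioo fun t ht => ?_
          refine ENNReal.div_le_div ?_ (ENNReal.ofReal_le_ofReal ht.2.le)
          exact ENNReal.rpow_le_rpow (mul_le_mul' (ENNReal.ofReal_le_ofReal ht.1.le)
            (hsub t ht.2)) hq0.le
      _ ≤ _ := lintegral_mono_set fun t ht => lt_trans (half_pos hc) ht.1

theorem lintegral_Ioi_comp_mul_left {c : ℝ} (hc : 0 < c) (φ : ℝ → ℝ≥0∞) :
    ∫⁻ t in Ioi 0, φ t = ENNReal.ofReal c * ∫⁻ t in Ioi 0, φ (c * t) := by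
  have him : (fun t : ℝ => c * t) '' Ioi 0 = Ioi 0 := by
    rw [image_mul_left_Ioi hc, mul_zero]
  have h := lintegral_image_eq_lintegral_abs_deriv_mul (s := Ioi (0 : ℝ)) (f := fun t => c * t)
    (f' := fun _ => c) measurableSet_Ioi
    (fun x _ => by simpa using ((hasDerivAt_id x).const_mul c).hasDerivWithinAt)
    (fun x _ y _ hxy => mul_left_cancel₀ hc.ne' hxy) φ
  rw [him] at h
  rw [h, abs_of_pos hc, lintegral_const_mul' _ _ ENNReal.ofReal_ne_top]

theorem lorentzOne_const_mul {p c : ℝ} (hc : 0 < c) (μ : Measure X) (g : X → ℝ≥0∞) :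
    lorentzOne p μ (fun x => ENNReal.ofReal c * g x) = ENNReal.ofReal c * lorentzOne p μ g := by
  unfold lorentzOne
  rw [lintegral_Ioi_comp_mul_left hc]
  congr 2
  ext t
  congr 2
  ext x
  simp only [mem_ofPred_eq]
  rw [ENNReal.ofReal_mul hc.le, ENNReal.mul_lt_mul_iff_right (by simpa using hc)
    ENNReal.ofReal_ne_top]

/-- If g + h > t then 2g > t or 2h > t. The power 1/p ≤ 1 is subadditive, and the dilation by 2
produces the factor 2. -/
theorem lorentzOne_add_le {p : ℝ} (hp : 1 ≤ p) (μ : Measure X) (g h : X → ℝ≥0∞) :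
    lorentzOne p μ (fun x => g x + h x) ≤ 2 * (lorentzOne p μ g + lorentzOne p μ h) := by
  have hp0 : 0 < p := by linarith
  have e2 : ENNReal.ofReal 2 = 2 := by simp
  rw [mul_add, ← e2, ← lorentzOne_const_mul two_pos, ← lorentzOne_const_mul two_pos]
  unfold lorentzOne
  rw [← lintegral_add_left (antitone_measure_superlevel_rpow hp0 μ _).measurable]
  refine lintegral_mono fun t => ?_
  refine le_trans (ENNReal.rpow_le_rpow ((measure_mono ?_).trans (measure_union_le _ _))
    (by positivity)) (ENNReal.rpow_add_le_add_rpow _ _ (by positivity)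
      (by rw [div_le_one hp0]; exact hp))
  intro x hx
  simp only [mem_ofPred_eq, mem_union] at hx ⊢
  by_contra hcon
  push Not at hcon
  rw [e2] at hcon
  have h3 : 2 * (g x + h x) ≤ 2 * ENNReal.ofReal t := by
    rw [mul_add, two_mul (ENNReal.ofReal t)]
    exact add_le_add hcon.1 hcon.2
  exact absurd hx (not_lt.2 ((ENNReal.mul_le_mul_iff_right (by simp) (by simp)).1 h3))

theorem ENNReal.rpow_sum_le_sum_rpow_of_le_one {ι : Type*} {r : ℝ} (hr : 0 < r) (hr1 : r ≤ 1)
    (s : Finset ι) (f : ι → ℝ≥0∞) : (∑ i ∈ s, f i) ^ r ≤ ∑ i ∈ s, f i ^ r := by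
  classical
  induction s using Finset.induction_on with
  | empty => simp [hr]
  | insert a s ha ih =>
    rw [Finset.sum_insert ha, Finset.sum_insert ha]
    exact (ENNReal.rpow_add_le_add_rpow _ _ hr.le hr1).trans (add_le_add le_rfl ih)

theorem ENNReal.rpow_tsum_le_tsum_rpow_of_le_one {ι : Type*} {r : ℝ} (hr : 0 < r) (hr1 : r ≤ 1)
    (f : ι → ℝ≥0∞) : (∑' i, f i) ^ r ≤ ∑' i, f i ^ r := by
  rw [ENNReal.tsum_eq_iSup_sum, (ENNReal.monotone_rpow_of_nonneg hr.le).map_iSup_of_continuousAt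
    (ENNReal.continuous_rpow_const.continuousAt) (by simp [hr])]
  exact iSup_le fun s => (rpow_sum_le_sum_rpow_of_le_one hr hr1 s f).trans (ENNReal.sum_le_tsum s)

/-- A pointwise domination by one of the `h i` gives a union of superlevel sets rather than a sum of
functions, so no constant is lost. It serves to add up infinitely many components. -/
theorem lorentzOne_le_tsum {ι : Type*} [Countable ι] {p : ℝ} (hp : 1 ≤ p) (μ : Measure X)
    {g : X → ℝ≥0∞} {h : ι → X → ℝ≥0∞} (hgh : ∀ x, ∃ i, g x ≤ h i x) :
    lorentzOne p μ g ≤ ∑' i, lorentzOne p μ (h i) := by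
  have hp0 : 0 < p := by linarith
  unfold lorentzOne
  rw [← lintegral_tsum fun i => (antitone_measure_superlevel_rpow hp0 μ _).measurable.aemeasurable]
  refine lintegral_mono fun t => ?_
  refine le_trans (ENNReal.rpow_le_rpow ((measure_mono (t := ⋃ i, {x | ENNReal.ofReal t < h i x})
    ?_).trans (measure_iUnion_le _)) (by positivity))
    (ENNReal.rpow_tsum_le_tsum_rpow_of_le_one (by positivity)
      (by rw [div_le_one hp0]; exact hp) _)
  intro x hx
  obtain ⟨i, hi⟩ := hgh x
  exact mem_iUnion.2 ⟨i, lt_of_lt_of_le hx hi⟩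

theorem lorentzOne_indicator_const {p : ℝ} (hp : 0 < p) (μ : Measure X) (E : Set X) {c : ℝ≥0∞}
    (hc : c ≠ ∞) : lorentzOne p μ (E.indicator fun _ => c) = c * μ E ^ (1 / p) := by
  have h1 : ∀ t ∈ Ioi (0 : ℝ), μ {x | ENNReal.ofReal t < E.indicator (fun _ => c) x} ^ (1 / p)
      = (Iio c.toReal).indicator (fun _ => μ E ^ (1 / p)) t := by
    intro t ht
    have ht' : (0 : ℝ) < t := ht
    by_cases htc : t < c.toReal
    · rw [indicator_of_mem (by exact htc)]
      congr 2
      ext x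
      have : ENNReal.ofReal t < c := (ENNReal.ofReal_lt_iff_lt_toReal ht'.le hc).2 htc
      by_cases hx : x ∈ E <;> simp [hx, this]
    · rw [indicator_of_notMem (by exact htc)]
      have : {x | ENNReal.ofReal t < E.indicator (fun _ => c) x} = ∅ := by
        ext x
        have : ¬ ENNReal.ofReal t < c := fun h =>
          htc ((ENNReal.ofReal_lt_iff_lt_toReal ht'.le hc).1 h)
        by_cases hx : x ∈ E <;> simp [hx]
        exact not_lt.1 this
      rw [this, measure_empty, ENNReal.zero_rpow_of_pos (by positivity)]
  unfold lorentzOne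
  rw [setLIntegral_congr_fun measurableSet_Ioi h1, setLIntegral_indicator measurableSet_Iio,
    setLIntegral_const, Iio_inter_Ioi, Real.volume_Ioo, sub_zero, ENNReal.ofReal_toReal hc,
    mul_comm]

/-- A weight in the dual weak space pairs boundedly with `L^{p,1}`. -/
theorem lintegral_mul_le_lorentzOne {p : ℝ} {μ : Measure X} {w : X → ℝ≥0∞} (hw : Measurable w)
    {K : ℝ≥0∞} (hK : K ≠ ∞)
    (hwK : ∀ A : Set X, MeasurableSet A → ∫⁻ x in A, w x ∂μ ≤ K * μ A ^ (1 / p))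
    {f : X → ℝ} (hf : Measurable f) (hf0 : ∀ x, 0 ≤ f x) :
    ∫⁻ x, w x * ENNReal.ofReal (f x) ∂μ ≤ K * lorentzOne p μ (fun x => ENNReal.ofReal (f x)) := by
  have h1 : ∫⁻ x, w x * ENNReal.ofReal (f x) ∂μ
      = ∫⁻ x, ENNReal.ofReal (f x) ∂(μ.withDensity w) := by
    rw [lintegral_withDensity_eq_lintegral_mul _ hw hf.ennreal_ofReal]
    rfl
  -- Layer cake for the measure with density w; the hypothesis on w is then applied to each
  -- superlevel set.
  rw [h1, lintegral_eq_lintegral_meas_lt _ (ae_of_all _ hf0) hf.aemeasurable]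
  unfold lorentzOne
  rw [← lintegral_const_mul' _ _ hK]
  refine setLIntegral_mono' measurableSet_Ioi fun t ht => ?_
  have ht' : (0 : ℝ) < t := ht
  have hm : MeasurableSet {a | t < f a} := measurableSet_lt measurable_const hf
  have e : {x | ENNReal.ofReal t < ENNReal.ofReal (f x)} = {a | t < f a} := by
    ext x
    simp only [mem_ofPred_eq]
    rw [ENNReal.ofReal_lt_ofReal_iff_of_nonneg ht'.le]
  rw [withDensity_apply _ hm, e]
  exact hwK _ hm

end LorentzOne

/-! ### Independence and variance on a finite product. -/

section ProductVariance

variable {I : Type*} [Fintype I] [DecidableEq I] {n : I → ℕ}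

/-- The product-of-sums expansion with every factor except the i-th constantly 1. -/
theorem sum_pi_apply_mul (i : I) (φ : Fin (n i) → ℝ) :
    (n i : ℝ) * ∑ x : ∀ i, Fin (n i), φ (x i)
      = Fintype.card (∀ i, Fin (n i)) * ∑ j, φ j := by
  have h := Finset.prod_univ_sum (fun i => (Finset.univ : Finset (Fin (n i))))
    (Function.update (fun (a : I) (_ : Fin (n a)) => (1 : ℝ)) i φ)
  rw [Fintype.piFinset_univ] at h
  have h1 : ∀ x : ∀ i, Fin (n i),
      ∏ a, Function.update (fun (a : I) (_ : Fin (n a)) => (1 : ℝ)) i φ a (x a) = φ (x i) := by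
    intro x
    rw [Finset.prod_eq_single i]
    · simp
    · intro b _ hb
      simp [Function.update_of_ne hb]
    · simp
  simp only [h1] at h
  have h2 : ∏ a ∈ Finset.univ.erase i,
      ∑ j, Function.update (fun (a : I) (_ : Fin (n a)) => (1 : ℝ)) i φ a j
      = ∏ a ∈ Finset.univ.erase i, (n a : ℝ) := by
    refine Finset.prod_congr rfl fun b hb => ?_
    rw [Function.update_of_ne (Finset.ne_of_mem_erase hb)]
    simp
  rw [← h, ← Finset.mul_prod_erase _ _ (Finset.mem_univ i), Function.update_self, h2,
    Fintype.card_pi, Nat.cast_prod, ← Finset.mul_prod_erase _ _ (Finset.mem_univ i)]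
  simp only [Fintype.card_fin]
  ring

/-- Distinct coordinates are independent, so the sum factors, and the factor at k vanishes. -/
theorem sum_pi_apply_mul_apply_eq_zero {i k : I} (hik : i ≠ k) (φ : Fin (n i) → ℝ)
    (ψ : Fin (n k) → ℝ) (hψ : ∑ j, ψ j = 0) :
    ∑ x : ∀ i, Fin (n i), φ (x i) * ψ (x k) = 0 := by
  have h := Finset.prod_univ_sum (fun i => (Finset.univ : Finset (Fin (n i))))
    (Function.update (Function.update (fun (a : I) (_ : Fin (n a)) => (1 : ℝ)) i φ) k ψ)
  rw [Fintype.piFinset_univ] at h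
  have h1 : ∀ x : ∀ i, Fin (n i),
      ∏ a, Function.update (Function.update (fun (a : I) (_ : Fin (n a)) => (1 : ℝ)) i φ) k ψ a
        (x a) = φ (x i) * ψ (x k) := by
    intro x
    rw [← Finset.mul_prod_erase _ _ (Finset.mem_univ k), Function.update_self, mul_comm]
    congr 1
    rw [Finset.prod_eq_single i]
    · simp [Function.update_of_ne hik]
    · intro b hb hbi
      simp [Function.update_of_ne (Finset.ne_of_mem_erase hb), Function.update_of_ne hbi]
    · intro hi
      simp [hik] at hi
  simp only [h1] at h
  rw [← h]
  exact Finset.prod_eq_zero (Finset.mem_univ k) (by simp [hψ])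

/-- The variance of a sum of independent variables on a finite product space. -/
theorem sum_pi_sq_sum_sub_mean_le (hn : ∀ i, 0 < n i) (u : ∀ i, Fin (n i) → ℝ) :
    ∑ x : ∀ i, Fin (n i), (∑ i, (u i (x i) - (∑ j, u i j) / n i)) ^ 2
      ≤ Fintype.card (∀ i, Fin (n i)) * ∑ i, (∑ j, u i j ^ 2) / n i := by
  set v : ∀ i, Fin (n i) → ℝ := fun i j => u i j - (∑ j, u i j) / n i with hv
  have hn' : ∀ i, (0 : ℝ) < n i := fun i => by exact_mod_cast hn i
  have hv0 : ∀ i, ∑ j, v i j = 0 := by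
    intro i
    simp only [hv, Finset.sum_sub_distrib, Finset.sum_const, Finset.card_univ, Fintype.card_fin,
      nsmul_eq_mul]
    have := hn' i
    field_simp
    ring
  have hvsq : ∀ i, ∑ j, v i j ^ 2 ≤ ∑ j, u i j ^ 2 := by
    intro i
    have e : ∀ j, u i j ^ 2 = v i j ^ 2 + 2 * ((∑ j, u i j) / n i) * v i j
        + ((∑ j, u i j) / n i) ^ 2 := by
      intro j
      simp only [hv]
      ring
    simp only [e, Finset.sum_add_distrib, ← Finset.mul_sum, hv0, mul_zero, add_zero]
    exact le_add_of_nonneg_right (Finset.sum_nonneg fun _ _ => sq_nonneg _)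
  -- After centering, the covariances of distinct coordinates vanish and only the diagonal terms
  -- remain.
  have e1 : ∑ x : ∀ i, Fin (n i), (∑ i, v i (x i)) ^ 2
      = ∑ i, ∑ x : ∀ i, Fin (n i), v i (x i) ^ 2 := by
    simp only [sq, Finset.sum_mul_sum]
    rw [Finset.sum_comm]
    refine Finset.sum_congr rfl fun i _ => ?_
    rw [Finset.sum_comm, Finset.sum_eq_single i]
    · intro k _ hk
      exact sum_pi_apply_mul_apply_eq_zero hk.symm _ _ (hv0 k)
    · simp
  rw [e1, Finset.mul_sum]
  refine Finset.sum_le_sum fun i _ => ?_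
  have h2 := sum_pi_apply_mul i (fun j => v i j ^ 2)
  have h3 : ∑ x : ∀ i, Fin (n i), v i (x i) ^ 2
      = Fintype.card (∀ i, Fin (n i)) * ((∑ j, v i j ^ 2) / n i) := by
    have := (hn' i).ne'
    field_simp
    linarith
  rw [h3]
  exact mul_le_mul_of_nonneg_left (div_le_div_of_nonneg_right (hvsq i) (hn' i).le) (by positivity)

end ProductVariance

/-! ### Chebyshev's inequality, its consequence for L^{p,1}, and a dyadic sum. -/

theorem card_filter_lt_abs_mul_sq_le {E : Type*} [Fintype E] (G : E → ℝ) {t : ℝ} (ht : 0 ≤ t)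
    [DecidablePred fun x => t < |G x|] :
    ((Finset.univ.filter fun x => t < |G x|).card : ℝ) * t ^ 2 ≤ ∑ x, G x ^ 2 := by
  rw [← nsmul_eq_mul]
  calc (Finset.univ.filter fun x => t < |G x|).card • t ^ 2
      ≤ ∑ x ∈ Finset.univ.filter fun x => t < |G x|, G x ^ 2 := by
        refine Finset.card_nsmul_le_sum _ _ _ fun x hx => ?_
        have := (Finset.mem_filter.1 hx).2
        rw [← sq_abs (G x)]
        exact pow_le_pow_left₀ ht this.le 2
    _ ≤ _ := Finset.sum_le_sum_of_subset_of_nonneg (Finset.filter_subset _ _)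
        fun _ _ _ => sq_nonneg _

/-- Since min(1, V/t²) ≤ 1 and s ≤ 1/p, its power 1/p is at most (V/t²)^s. The condition s < 1/2
makes t^(-2s) integrable at 0, and the sup bound H cuts the integral off. The parameter s trades
variance against height. -/
theorem lorentzOne_le_of_measure_le {X : Type*} [MeasurableSpace X] {μ : Measure X} {p s : ℝ}
    (hp : 0 < p) (hs0 : 0 ≤ s) (hs : s < 1 / 2) (hsp : s ≤ 1 / p) {a V H : ℝ} (ha : 0 ≤ a)
    (hV : 0 ≤ V) (hH : 0 ≤ H) {g : X → ℝ≥0∞}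
    (h1 : ∀ t, 0 < t → μ {x | ENNReal.ofReal t < g x} ≤ ENNReal.ofReal a)
    (h2 : ∀ t, 0 < t → μ {x | ENNReal.ofReal t < g x} ≤ ENNReal.ofReal (a * (V / t ^ 2)))
    (h3 : ∀ x, g x ≤ ENNReal.ofReal H) :
    lorentzOne p μ g ≤ ENNReal.ofReal (a ^ (1 / p) * V ^ s * H ^ (1 - 2 * s) / (1 - 2 * s)) := by
  have hp' : 0 < 1 / p := by positivity
  have key : ∀ t ∈ Ioi (0 : ℝ), μ {x | ENNReal.ofReal t < g x} ^ (1 / p)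
      ≤ (Iio H).indicator (fun t => ENNReal.ofReal (a ^ (1 / p) * V ^ s * t ^ (-(2 * s)))) t := by
    intro t ht
    have ht' : (0 : ℝ) < t := ht
    by_cases htH : t < H
    · rw [indicator_of_mem (by exact htH)]
      have hmin : μ {x | ENNReal.ofReal t < g x} ≤ ENNReal.ofReal (a * min 1 (V / t ^ 2)) := by
        rcases min_choice 1 (V / t ^ 2) with h | h
        · rw [h, mul_one]; exact h1 t ht'
        · rw [h]; exact h2 t ht'
      have hm0 : 0 ≤ min 1 (V / t ^ 2) := by positivity
      refine (ENNReal.rpow_le_rpow hmin hp'.le).trans ?_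
      rw [ENNReal.ofReal_rpow_of_nonneg (by positivity) hp'.le,
        Real.mul_rpow ha hm0]
      refine ENNReal.ofReal_le_ofReal ?_
      rw [mul_assoc]
      refine mul_le_mul_of_nonneg_left ?_ (by positivity)
      calc min 1 (V / t ^ 2) ^ (1 / p) ≤ min 1 (V / t ^ 2) ^ s :=
            Real.rpow_le_rpow_of_exponent_ge_of_imp hm0 (min_le_left _ _) hsp
              (fun _ h => absurd h hp'.ne')
        _ ≤ (V / t ^ 2) ^ s := Real.rpow_le_rpow hm0 (min_le_right _ _) hs0
        _ = V ^ s * t ^ (-(2 * s)) := by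
            rw [Real.div_rpow hV (by positivity), div_eq_mul_inv, ← Real.rpow_natCast t 2,
              ← Real.rpow_mul ht'.le, ← Real.rpow_neg ht'.le]
            norm_num
    · have : {x | ENNReal.ofReal t < g x} = ∅ := by
        ext x
        simp only [mem_ofPred_eq, mem_empty_iff_false, iff_false, not_lt]
        exact (h3 x).trans (ENNReal.ofReal_le_ofReal (not_lt.1 htH))
      rw [this, measure_empty, ENNReal.zero_rpow_of_pos hp']
      exact zero_le
  refine (setLIntegral_mono' measurableSet_Ioi key).trans ?_
  rw [setLIntegral_indicator measurableSet_Iio, Iio_inter_Ioi]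
  have hint : IntervalIntegrable (fun t : ℝ => t ^ (-(2 * s))) volume 0 H :=
    intervalIntegral.intervalIntegrable_rpow' (by linarith)
  have hint2 : IntegrableOn (fun t : ℝ => a ^ (1 / p) * V ^ s * t ^ (-(2 * s))) (Ioc 0 H) :=
    ((intervalIntegrable_iff_integrableOn_Ioc_of_le hH).1 hint).const_mul _
  refine (lintegral_mono_set Ioo_subset_Ioc_self).trans ?_
  rw [← ofReal_integral_eq_lintegral_ofReal hint2 ((ae_restrict_iff' measurableSet_Ioc).2
    (ae_of_all _ fun t ht => by have := ht.1; positivity))]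
  rw [integral_const_mul, ← intervalIntegral.integral_of_le hH, integral_rpow (Or.inl (by linarith))]
  rw [Real.zero_rpow (by linarith), sub_zero, show -(2 * s) + 1 = 1 - 2 * s by ring, mul_div_assoc]

/-- The terms grow geometrically until 2^(-j) is about u and then decay geometrically, so the sum is
comparable to its peak u^a. It shows that the dual weight lies in the weak dual space. -/
theorem exists_tsum_rpow_mul_min_le {a : ℝ} (ha : 0 < a) (ha1 : a < 1) :
    ∃ K : ℝ≥0∞, K ≠ ∞ ∧ ∀ u : ℝ≥0∞,
      ∑' j : ℕ, ENNReal.ofReal ((2 : ℝ) ^ ((j : ℝ) * (1 - a)))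
        * min (ENNReal.ofReal ((2 : ℝ) ^ (-(j : ℝ)))) u ≤ K * u ^ a := by
  set ρ : ℝ := max ((2 : ℝ) ^ (-(1 - a))) ((2 : ℝ) ^ (-a)) with hρ
  have hρ0 : 0 ≤ ρ := le_max_of_le_left (by positivity)
  have hρ1 : ρ < 1 := max_lt (Real.rpow_lt_one_of_one_lt_of_neg (by norm_num) (by linarith))
    (Real.rpow_lt_one_of_one_lt_of_neg (by norm_num) (by linarith))
  have hsum : Summable fun k : ℤ => (2 : ℝ) ^ a * ρ ^ k.natAbs := by
    refine Summable.mul_left _ (Summable.of_nat_of_neg ?_ ?_)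
    · simpa using summable_geometric_of_lt_one hρ0 hρ1
    · simpa using summable_geometric_of_lt_one hρ0 hρ1
  refine ⟨∑' k : ℤ, ENNReal.ofReal ((2 : ℝ) ^ a * ρ ^ k.natAbs), ?_, fun u => ?_⟩
  · rw [← ENNReal.ofReal_tsum_of_nonneg (fun k => by positivity) hsum]
    exact ENNReal.ofReal_ne_top
  rcases eq_or_ne u 0 with rfl | hu0
  · simp
  have hle1 : ∀ j : ℕ, ENNReal.ofReal ((2 : ℝ) ^ (-(j : ℝ))) ≤ 1 := fun j => by
    rw [← ENNReal.ofReal_one]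
    exact ENNReal.ofReal_le_ofReal (Real.rpow_le_one_of_one_le_of_nonpos (by norm_num) (by simp))
  -- Every 2^(-j) is at most 1, so u may be replaced by min u 1, which is finite.
  have hm : min u 1 ≠ ∞ := ne_top_of_le_ne_top ENNReal.one_ne_top (min_le_right _ _)
  obtain ⟨x, hx0, hx1, hxu⟩ : ∃ x : ℝ, 0 < x ∧ x ≤ 1 ∧ min u 1 = ENNReal.ofReal x := by
    refine ⟨(min u 1).toReal, ENNReal.toReal_pos ?_ hm, ?_, (ENNReal.ofReal_toReal hm).symm⟩
    · simpa using hu0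
    · simpa using ENNReal.toReal_mono ENNReal.one_ne_top (min_le_right u 1)
  obtain ⟨J, hJ1, hJ2⟩ := exists_nat_pow_near_of_lt_one hx0 hx1 (y := (1 / 2 : ℝ)) (by norm_num)
    (by norm_num)
  have hJ1' : (2 : ℝ) ^ (-((J : ℝ) + 1)) < x := by
    refine lt_of_eq_of_lt ?_ hJ1
    rw [Real.rpow_neg (by norm_num), one_div, inv_pow, ← Real.rpow_natCast]
    push_cast
    rfl
  have hJ2' : x ≤ (2 : ℝ) ^ (-(J : ℝ)) := by
    refine hJ2.trans_eq ?_
    rw [Real.rpow_neg (by norm_num), one_div, inv_pow, ← Real.rpow_natCast]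
  have hterm : ∀ j : ℕ, (2 : ℝ) ^ ((j : ℝ) * (1 - a)) * min ((2 : ℝ) ^ (-(j : ℝ))) x
      ≤ (2 : ℝ) ^ a * ρ ^ ((j : ℤ) - J).natAbs * x ^ a := by
    intro j
    have h2a : 1 ≤ (2 : ℝ) ^ a := Real.one_le_rpow (by norm_num) ha.le
    rcases le_or_gt j J with hj | hj
    · have hab : ((j : ℤ) - J).natAbs = J - j := by omega
      calc (2 : ℝ) ^ ((j : ℝ) * (1 - a)) * min ((2 : ℝ) ^ (-(j : ℝ))) x
          ≤ (2 : ℝ) ^ ((j : ℝ) * (1 - a)) * x := by gcongr; exact min_le_right _ _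
        _ = (2 : ℝ) ^ ((j : ℝ) * (1 - a)) * (x ^ (1 - a) * x ^ a) := by
            rw [← Real.rpow_add hx0]; simp
        _ ≤ (2 : ℝ) ^ ((j : ℝ) * (1 - a)) * (((2 : ℝ) ^ (-(J : ℝ))) ^ (1 - a) * x ^ a) := by
            gcongr
        _ = ((2 : ℝ) ^ (-(1 - a))) ^ (J - j) * x ^ a := by
            rw [← mul_assoc, ← Real.rpow_mul (by norm_num), ← Real.rpow_add (by norm_num),
              ← Real.rpow_natCast, ← Real.rpow_mul (by norm_num), Nat.cast_sub hj]
            congr 2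
            ring
        _ ≤ ρ ^ (J - j) * x ^ a := by
            gcongr
            exact le_max_left _ _
        _ ≤ (2 : ℝ) ^ a * ρ ^ ((j : ℤ) - J).natAbs * x ^ a := by
            rw [hab]
            gcongr
            exact le_mul_of_one_le_left (by positivity) h2a
    · have hab : ((j : ℤ) - J).natAbs = j - J := by omega
      calc (2 : ℝ) ^ ((j : ℝ) * (1 - a)) * min ((2 : ℝ) ^ (-(j : ℝ))) x
          ≤ (2 : ℝ) ^ ((j : ℝ) * (1 - a)) * (2 : ℝ) ^ (-(j : ℝ)) := by
            gcongr; exact min_le_left _ _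
        _ = (2 : ℝ) ^ a * ((2 : ℝ) ^ (-a)) ^ (j - J) * ((2 : ℝ) ^ (-((J : ℝ) + 1))) ^ a := by
            rw [← Real.rpow_natCast, ← Real.rpow_mul (by norm_num), ← Real.rpow_mul (by norm_num),
              ← Real.rpow_add (by norm_num), ← Real.rpow_add (by norm_num),
              ← Real.rpow_add (by norm_num), Nat.cast_sub hj.le]
            congr 1
            ring
        _ ≤ (2 : ℝ) ^ a * ρ ^ ((j : ℤ) - J).natAbs * x ^ a := by
            rw [hab]
            gcongr
            exact le_max_right _ _
  calc ∑' j : ℕ, ENNReal.ofReal ((2 : ℝ) ^ ((j : ℝ) * (1 - a)))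
        * min (ENNReal.ofReal ((2 : ℝ) ^ (-(j : ℝ)))) u
      ≤ ∑' j : ℕ, ENNReal.ofReal ((2 : ℝ) ^ a * ρ ^ ((j : ℤ) - J).natAbs) * u ^ a := by
        refine ENNReal.tsum_le_tsum fun j => ?_
        have e : min (ENNReal.ofReal ((2 : ℝ) ^ (-(j : ℝ)))) u
            = ENNReal.ofReal (min ((2 : ℝ) ^ (-(j : ℝ))) x) := by
          rw [ENNReal.ofReal_min, ← hxu, min_comm u, ← min_assoc, min_eq_left (hle1 j)]
        rw [e, ← ENNReal.ofReal_mul (by positivity)]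
        refine (ENNReal.ofReal_le_ofReal (hterm j)).trans ?_
        rw [ENNReal.ofReal_mul (by positivity), ← ENNReal.ofReal_rpow_of_nonneg hx0.le ha.le, ← hxu]
        exact mul_le_mul_right (ENNReal.rpow_le_rpow (min_le_left _ _) ha.le) _
    _ = (∑' j : ℕ, ENNReal.ofReal ((2 : ℝ) ^ a * ρ ^ ((j : ℤ) - J).natAbs)) * u ^ a :=
        ENNReal.tsum_mul_right
    _ ≤ _ := by
        -- Reindexing by j - J into ℤ makes the constant independent of u.
        refine mul_le_mul_left (ENNReal.tsum_comp_le_tsum_of_injective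
          (f := fun j : ℕ => (j : ℤ) - J) (fun x y h => by simpa using h)
          (fun k => ENNReal.ofReal ((2 : ℝ) ^ a * ρ ^ k.natAbs))) _

/-! ### The points, the metric and the balls of the test space. -/

section TestSpace

/-- The labels of the groups of atoms in the `N`-th component: a shell `l ≤ N` and one of the `L N`
groups into which the shell is divided. -/
abbrev GroupIndex (L : ℕ → ℕ) (N : ℕ) : Type := Fin (N + 1) × Fin (L N)

/-- The inner points of the `N`-th component: a group in the shell `l` has `n l` points. -/
abbrev InnerPart (n L : ℕ → ℕ) (N : ℕ) : Type := Σ i : GroupIndex L N, Fin (n i.1)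

/-- The outer points of the `N`-th component: all choices of one inner point from each group. -/
abbrev OuterPart (n L : ℕ → ℕ) (N : ℕ) : Type := ∀ i : GroupIndex L N, Fin (n i.1)

/-- The disjoint union of all components. -/
def TestSpace (n L : ℕ → ℕ) : Type := Σ N : ℕ, InnerPart n L N ⊕ OuterPart n L N

variable {n L : ℕ → ℕ}

namespace TestSpace

/-- The inner point `y` of the component `N`. -/
def inner (N : ℕ) (y : InnerPart n L N) : TestSpace n L := ⟨N, Sum.inl y⟩

/-- The outer point `x` of the component `N`. -/
def outer (N : ℕ) (x : OuterPart n L N) : TestSpace n L := ⟨N, Sum.inr x⟩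

/-- The number of the component of a point. -/
def comp (z : TestSpace n L) : ℕ := z.1

/-- The point is an inner point. -/
def IsInner (z : TestSpace n L) : Prop := ∃ N y, z = inner N y

/-- An outer point and an inner point chosen by it. -/
def Linked (z w : TestSpace n L) : Prop :=
  ∃ N y x, x y.1 = y.2 ∧ (z = inner N y ∧ w = outer N x ∨ z = outer N x ∧ w = inner N y)

theorem cases (z : TestSpace n L) : (∃ N y, z = inner N y) ∨ ∃ N x, z = outer N x := by
  rcases z with ⟨N, y | x⟩
  · exact Or.inl ⟨N, y, rfl⟩
  · exact Or.inr ⟨N, x, rfl⟩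

theorem inner_injective (N : ℕ) : Function.Injective (inner (n := n) (L := L) N) :=
    fun _ _ h => Sum.inl_injective (sigma_mk_injective (β := fun N => InnerPart n L N ⊕ OuterPart n L N) h)

theorem outer_injective (N : ℕ) : Function.Injective (outer (n := n) (L := L) N) :=
    fun _ _ h => Sum.inr_injective (sigma_mk_injective (β := fun N => InnerPart n L N ⊕ OuterPart n L N) h)

theorem inner_ne_outer (N M : ℕ) (y : InnerPart n L N) (x : OuterPart n L M) :
    inner N y ≠ outer M x := by
  intro h
  obtain rfl : N = M := congrArg Sigma.fst h
  exact Sum.inl_ne_inr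
    (sigma_mk_injective (β := fun N => InnerPart n L N ⊕ OuterPart n L N) h)

theorem isInner_inner (N : ℕ) (y : InnerPart n L N) : IsInner (inner N y) := ⟨N, y, rfl⟩

theorem not_isInner_outer (N : ℕ) (x : OuterPart n L N) : ¬ IsInner (outer N x) := by
  rintro ⟨M, y, h⟩
  exact inner_ne_outer _ _ _ _ h.symm

theorem linked_comm (z w : TestSpace n L) : Linked z w ↔ Linked w z := by
  unfold Linked
  constructor <;>
  · rintro ⟨N, y, x, hx, h⟩
    exact ⟨N, y, x, hx, by tauto⟩

theorem linked_outer_inner (N : ℕ) (x : OuterPart n L N) (y : InnerPart n L N) :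
    Linked (outer N x) (inner N y) ↔ x y.1 = y.2 := by
  constructor
  · rintro ⟨M, y', x', h, h' | h'⟩
    · exact absurd h'.1.symm (inner_ne_outer _ _ _ _)
    · obtain rfl : N = M := congrArg Sigma.fst h'.1
      rw [outer_injective N h'.1, inner_injective N h'.2]
      exact h
  · exact fun h => ⟨N, y, x, h, Or.inr ⟨rfl, rfl⟩⟩

open Classical in
/-- The distance on the test space. -/
noncomputable def distance (z w : TestSpace n L) : ℝ :=
  -- Distances between distinct points of one component lie in [1, 2], so the triangle inequality
  -- there is automatic. The intermediate value 3/2 isolates the linked points in the balls of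
  -- radius in (3/2, 2] around outer points.
  if z = w then 0
  else if comp z ≠ comp w then 3
  else if IsInner z ∧ IsInner w then 1
  else if Linked z w then 3 / 2
  else 2

theorem distance_self (z : TestSpace n L) : distance z z = 0 := if_pos rfl

theorem distance_comm (z w : TestSpace n L) : distance z w = distance w z := by
  classical
  unfold distance
  exact if_congr eq_comm rfl (if_congr ne_comm rfl (if_congr and_comm rfl
    (if_congr (linked_comm z w) rfl rfl)))

theorem one_le_distance {z w : TestSpace n L} (h : z ≠ w) : 1 ≤ distance z w := by
  unfold distance
  rw [if_neg h]
  split_ifs <;> norm_num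

theorem distance_of_comp_ne {z w : TestSpace n L} (h : comp z ≠ comp w) : distance z w = 3 := by
  unfold distance
  rw [if_neg (fun e => h (congrArg comp e)), if_pos h]

theorem distance_le_two {z w : TestSpace n L} (h : comp z = comp w) : distance z w ≤ 2 := by
  unfold distance
  split_ifs <;> first | contradiction | norm_num

theorem distance_le_three (z w : TestSpace n L) : distance z w ≤ 3 := by
  by_cases h : comp z = comp w
  · linarith [distance_le_two h]
  · exact (distance_of_comp_ne h).le

/-- Inside a component any two nonzero legs add up to at least 2. If x and z lie in different
components, at least one leg already has length 3. -/
theorem distance_triangle (x y z : TestSpace n L) :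
    distance x z ≤ distance x y + distance y z := by
  rcases eq_or_ne x y with rfl | hxy
  · simp [distance_self]
  rcases eq_or_ne y z with rfl | hyz
  · simp [distance_self]
  have h1 := one_le_distance hxy
  have h2 := one_le_distance hyz
  by_cases h : comp x = comp z
  · linarith [distance_le_two h]
  · have h3 := distance_le_three x z
    by_cases h4 : comp x = comp y
    · rw [distance_of_comp_ne (z := y) (w := z) (fun e => h (h4.trans e))]
      linarith
    · rw [distance_of_comp_ne h4]
      linarith

noncomputable instance : MetricSpace (TestSpace n L) where
  dist := distance
  dist_self := distance_self
  dist_comm := distance_comm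
  dist_triangle := distance_triangle
  eq_of_dist_eq_zero {z w} h := by
    by_contra hne
    have := one_le_distance hne
    have h' : distance z w = 0 := h
    linarith

instance : MeasurableSpace (TestSpace n L) := ⊤

theorem dist_def (z w : TestSpace n L) : dist z w = distance z w := rfl

instance : DiscreteTopology (TestSpace n L) :=
  DiscreteTopology.of_forall_le_dist (r := 1) one_pos fun _ _ h => one_le_distance h

instance : BorelSpace (TestSpace n L) := ⟨borel_eq_top_of_discrete.symm⟩

instance : DiscreteMeasurableSpace (TestSpace n L) := ⟨fun _ => trivial⟩

instance : Countable (TestSpace n L) := by unfold TestSpace; infer_instance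

theorem isBounded_univ : Bornology.IsBounded (univ : Set (TestSpace n L)) :=
  isBounded_iff.2 ⟨3, fun z _ w _ => distance_le_three z w⟩

theorem ball_eq_singleton {z : TestSpace n L} {s : ℝ} (hs : 0 < s) (hs1 : s ≤ 1) :
    ball z s = {z} := by
  ext w
  rw [mem_ball, mem_singleton_iff]
  constructor
  · intro h
    by_contra hne
    have := one_le_distance hne
    rw [dist_def] at h
    linarith
  · rintro rfl
    simpa using hs

theorem ball_subset_comp {z : TestSpace n L} {s : ℝ} (hs : s ≤ 3) :
    ball z s ⊆ {w | comp w = comp z} := by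
  intro w hw
  by_contra h
  rw [mem_ball, dist_def, distance_of_comp_ne h] at hw
  linarith

theorem ball_eq_univ {z : TestSpace n L} {s : ℝ} (hs : 3 < s) : ball z s = univ :=
  eq_univ_of_forall fun w => (distance_le_three w z).trans_lt hs

theorem inner_mem_ball_inner {N : ℕ} {y y' : InnerPart n L N} {s : ℝ} (hs : 1 < s) :
    inner N y' ∈ ball (inner N y) s := by
  rw [mem_ball, dist_def]
  refine lt_of_le_of_lt ?_ hs
  unfold distance
  split_ifs with h1 h2 h3
  · norm_num
  · exact absurd rfl h2
  · exact le_rfl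
  all_goals exact absurd ⟨isInner_inner _ _, isInner_inner _ _⟩ h3

theorem comp_subset_ball {z : TestSpace n L} {s : ℝ} (hs : 2 < s) :
    {w | comp w = comp z} ⊆ ball z s := fun _ hw => (distance_le_two hw).trans_lt hs

theorem distance_inner_outer (N : ℕ) (x : OuterPart n L N) (y : InnerPart n L N) :
    distance (inner N y) (outer N x) = if x y.1 = y.2 then 3 / 2 else 2 := by
  have h1 : inner N y ≠ outer N x := inner_ne_outer _ _ _ _
  have h2 : comp (inner N y) = comp (outer N x) := rfl
  unfold distance
  rw [if_neg h1, if_neg (not_not.2 h2), if_neg (fun h => not_isInner_outer _ _ h.2), linked_comm]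
  simp only [linked_outer_inner]

theorem distance_outer_outer (N : ℕ) {x x' : OuterPart n L N} (hx : x ≠ x') :
    distance (outer N x) (outer N x') = 2 := by
  have h1 : outer N x ≠ outer N x' := fun h => hx (outer_injective N h)
  have h2 : comp (outer N x) = comp (outer N x') := rfl
  unfold distance
  rw [if_neg h1, if_neg (not_not.2 h2), if_neg (fun h => not_isInner_outer _ _ h.2), if_neg]
  rintro ⟨M, y, x, -, h | h⟩
  · exact inner_ne_outer _ _ _ _ h.1.symm
  · exact inner_ne_outer _ _ _ _ h.2.symm

theorem ball_outer_eq_singleton {N : ℕ} {x : OuterPart n L N} {s : ℝ} (hs : 0 < s)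
    (hs1 : s ≤ 3 / 2) : ball (outer N x) s = {outer N x} := by
  ext w
  rw [mem_singleton_iff]
  constructor
  · intro h
    have hc : comp w = N := ball_subset_comp (by linarith) h
    rw [mem_ball, dist_def] at h
    rcases cases w with ⟨M, y, rfl⟩ | ⟨M, x', rfl⟩
    · obtain rfl : M = N := hc
      rw [distance_inner_outer] at h
      split_ifs at h <;> linarith
    · obtain rfl : M = N := hc
      by_contra hne
      rw [distance_outer_outer _ (fun e => hne (congrArg _ e))] at h
      linarith
  · rintro rfl
    simpa using hs

theorem ball_outer_eq {N : ℕ} {x : OuterPart n L N} {s : ℝ} (hs : 3 / 2 < s) (hs1 : s ≤ 2) :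
    ball (outer N x) s = insert (outer N x) (range fun i => inner N ⟨i, x i⟩) := by
  ext w
  rw [mem_insert_iff, mem_range]
  constructor
  · intro h
    have hc : comp w = N := ball_subset_comp (by linarith) h
    rw [mem_ball, dist_def] at h
    rcases cases w with ⟨M, y, rfl⟩ | ⟨M, x', rfl⟩
    · obtain rfl : M = N := hc
      rw [distance_inner_outer] at h
      split_ifs at h with h1
      · exact Or.inr ⟨y.1, by rw [h1]⟩
      · linarith
    · obtain rfl : M = N := hc
      by_contra hne
      rw [not_or] at hne
      rw [distance_outer_outer _ (fun e => hne.1 (congrArg _ e))] at h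
      linarith
  · rintro (rfl | ⟨i, rfl⟩)
    · exact mem_ball_self (by linarith)
    · rw [mem_ball, dist_def, distance_inner_outer, if_pos rfl]
      exact hs

end TestSpace

end TestSpace

/-! ### The measure of the test space and the dual weight. -/

section TestMeasure

variable {n L : ℕ → ℕ}

namespace TestSpace

/-- The mass of the shell `l ≤ N` in the component `N`, or of the outer part if `l = N + 1`. Different
pairs `(N, l)` give different powers of two. -/
noncomputable def mass (N l : ℕ) : ℝ := (2 : ℝ) ^ ((l : ℝ) - ((N : ℝ) + 2) ^ 2)

theorem mass_pos (N l : ℕ) : 0 < mass N l := by unfold mass; positivity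

/-- The mass of an atom. -/
noncomputable def weight : TestSpace n L → ℝ
  | ⟨N, Sum.inl y⟩ => mass N y.1.1 / (L N * n y.1.1)
  | ⟨N, Sum.inr _⟩ => mass N (N + 1) / Fintype.card (OuterPart n L N)

/-- The shell of a point, with the value `N + 1` on the outer part. -/
def shell : TestSpace n L → ℕ
  | ⟨_, Sum.inl y⟩ => y.1.1
  | ⟨N, Sum.inr _⟩ => N + 1

/-- The exponent `j` for which the shell of the point has mass `2 ^ (-j)`. -/
def level (z : TestSpace n L) : ℕ := (comp z + 2) ^ 2 - shell z

theorem weight_inner (N : ℕ) (y : InnerPart n L N) :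
    weight (inner N y) = mass N y.1.1 / (L N * n y.1.1) := rfl

theorem weight_outer (N : ℕ) (x : OuterPart n L N) :
    weight (outer N x) = mass N (N + 1) / Fintype.card (OuterPart n L N) := rfl

theorem weight_nonneg (z : TestSpace n L) : 0 ≤ weight z := by
  rcases cases z with ⟨N, y, rfl⟩ | ⟨N, x, rfl⟩
  · rw [weight_inner]; have := mass_pos N y.1.1; positivity
  · rw [weight_outer]; have := mass_pos N (N + 1); positivity

theorem weight_pos (hn : ∀ l, 0 < n l) (hL : ∀ N, 0 < L N) (z : TestSpace n L) :
    0 < weight z := by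
  rcases cases z with ⟨N, y, rfl⟩ | ⟨N, x, rfl⟩
  · rw [weight_inner]
    have := mass_pos N y.1.1
    have := hn y.1.1
    have := hL N
    positivity
  · rw [weight_outer]
    have := mass_pos N (N + 1)
    have : 0 < Fintype.card (OuterPart n L N) := Fintype.card_pos_iff.2 ⟨x⟩
    positivity

/-- The atomic measure on the test space. -/
noncomputable def vol : Measure (TestSpace n L) :=
  Measure.sum fun z => ENNReal.ofReal (weight z) • Measure.dirac z

theorem lintegral_vol (f : TestSpace n L → ℝ≥0∞) :
    ∫⁻ z, f z ∂vol = ∑' N : ℕ, (∑ y : InnerPart n L N, ENNReal.ofReal (weight (inner N y)) *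
      f (inner N y) + ∑ x : OuterPart n L N, ENNReal.ofReal (weight (outer N x)) *
      f (outer N x)) := by
  unfold vol
  rw [lintegral_sum_measure]
  simp only [lintegral_smul_measure, lintegral_dirac, smul_eq_mul]
  refine (ENNReal.tsum_sigma' (β := fun N => InnerPart n L N ⊕ OuterPart n L N)
    (fun z : TestSpace n L => ENNReal.ofReal (weight z) * f z)).trans ?_
  refine tsum_congr fun N => ?_
  rw [tsum_fintype, Fintype.sum_sum_type]
  rfl

theorem setLIntegral_vol_of_subset_comp {N : ℕ} {A : Set (TestSpace n L)}
    (hA : ∀ z ∈ A, comp z = N) (f : TestSpace n L → ℝ≥0∞) :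
    ∫⁻ z in A, f z ∂vol = ∑ y : InnerPart n L N, ENNReal.ofReal (weight (inner N y)) *
      A.indicator f (inner N y) + ∑ x : OuterPart n L N, ENNReal.ofReal (weight (outer N x)) *
      A.indicator f (outer N x) := by
  rw [← lintegral_indicator (MeasurableSet.of_discrete), lintegral_vol, tsum_eq_single N]
  intro M hM
  have h1 : ∀ y : InnerPart n L M, A.indicator f (inner M y) = 0 := fun y =>
    indicator_of_notMem (fun h => hM (show comp (inner M y) = N from hA _ h)) f
  have h2 : ∀ x : OuterPart n L M, A.indicator f (outer M x) = 0 := fun x =>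
    indicator_of_notMem (fun h => hM (show comp (outer M x) = N from hA _ h)) f
  simp [h1, h2]

theorem setLIntegral_vol_comp (N : ℕ) (f : TestSpace n L → ℝ≥0∞) :
    ∫⁻ z in {z : TestSpace n L | comp z = N}, f z ∂vol
      = ∑ y : InnerPart n L N, ENNReal.ofReal (weight (inner N y)) * f (inner N y)
        + ∑ x : OuterPart n L N, ENNReal.ofReal (weight (outer N x)) * f (outer N x) := by
  rw [setLIntegral_vol_of_subset_comp (A := {z : TestSpace n L | comp z = N}) (fun z hz => hz)]
  have h1 : ∀ y : InnerPart n L N, {z : TestSpace n L | comp z = N}.indicator f (inner N y)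
      = f (inner N y) := fun y =>
    indicator_of_mem (s := {z : TestSpace n L | comp z = N}) (a := inner N y) (by exact rfl) f
  have h2 : ∀ x : OuterPart n L N, {z : TestSpace n L | comp z = N}.indicator f (outer N x)
      = f (outer N x) := fun x =>
    indicator_of_mem (s := {z : TestSpace n L | comp z = N}) (a := outer N x) (by exact rfl) f
  simp only [h1, h2]

theorem lintegral_vol_eq_tsum (f : TestSpace n L → ℝ≥0∞) :
    ∫⁻ z, f z ∂vol = ∑' N : ℕ, ∫⁻ z in {z : TestSpace n L | comp z = N}, f z ∂vol := by
  rw [lintegral_vol]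
  simp only [setLIntegral_vol_comp]

/-- The integral over a component of a nonnegative function. -/
noncomputable def compSum (N : ℕ) (F : TestSpace n L → ℝ) : ℝ :=
  ∑ y : InnerPart n L N, weight (inner N y) * F (inner N y)
    + ∑ x : OuterPart n L N, weight (outer N x) * F (outer N x)

theorem compSum_nonneg (N : ℕ) {F : TestSpace n L → ℝ} (hF : ∀ z, 0 ≤ F z) : 0 ≤ compSum N F :=
  add_nonneg (Finset.sum_nonneg fun _ _ => mul_nonneg (weight_nonneg _) (hF _))
    (Finset.sum_nonneg fun _ _ => mul_nonneg (weight_nonneg _) (hF _))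

theorem setLIntegral_comp (N : ℕ) {F : TestSpace n L → ℝ} (hF : ∀ z, 0 ≤ F z) :
    ∫⁻ z in {z : TestSpace n L | comp z = N}, ENNReal.ofReal (F z) ∂vol
      = ENNReal.ofReal (compSum N F) := by
  rw [setLIntegral_vol_comp]
  unfold compSum
  rw [ENNReal.ofReal_add (Finset.sum_nonneg fun _ _ => mul_nonneg (weight_nonneg _) (hF _))
    (Finset.sum_nonneg fun _ _ => mul_nonneg (weight_nonneg _) (hF _)),
    ENNReal.ofReal_sum_of_nonneg (fun _ _ => mul_nonneg (weight_nonneg _) (hF _)),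
    ENNReal.ofReal_sum_of_nonneg (fun _ _ => mul_nonneg (weight_nonneg _) (hF _))]
  simp only [ENNReal.ofReal_mul (weight_nonneg _)]

theorem vol_singleton (z : TestSpace n L) : vol {z} = ENNReal.ofReal (weight z) := by
  unfold vol
  rw [Measure.sum_apply _ (MeasurableSet.of_discrete), tsum_eq_single z]
  · simp
  · intro w hw
    simp [hw]

theorem sum_weight_inner (hn : ∀ l, 0 < n l) (N : ℕ) (c : InnerPart n L N → ℝ) :
    ∑ y : InnerPart n L N, weight (inner N y) * c y
      = ∑ i : GroupIndex L N, mass N i.1 / L N * ((∑ j, c ⟨i, j⟩) / n i.1) := by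
  rw [Fintype.sum_sigma]
  refine Finset.sum_congr rfl fun i _ => ?_
  simp only [weight_inner, ← Finset.mul_sum]
  have : (n i.1 : ℝ) ≠ 0 := by exact_mod_cast (hn i.1).ne'
  rw [mul_div_assoc', div_mul_eq_mul_div, div_mul_eq_mul_div, div_div, mul_comm (L N : ℝ)]

theorem sum_weight_inner_shell (hn : ∀ l, 0 < n l) {N : ℕ} (hL : 0 < L N) (c : ℕ → ℝ) :
    ∑ y : InnerPart n L N, weight (inner N y) * c y.1.1
      = ∑ l ∈ Finset.range (N + 1), mass N l * c l := by
  rw [sum_weight_inner hn N fun y => c y.1.1, Fintype.sum_prod_type,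
    ← Fin.sum_univ_eq_sum_range (fun l => mass N l * c l)]
  refine Finset.sum_congr rfl fun l _ => ?_
  have h1 : (n l : ℝ) ≠ 0 := by exact_mod_cast (hn l).ne'
  have h2 : (L N : ℝ) ≠ 0 := by exact_mod_cast hL.ne'
  simp only [Finset.sum_const, Finset.card_univ, Fintype.card_fin, nsmul_eq_mul]
  field_simp

theorem sum_weight_outer (hn : ∀ l, 0 < n l) (N : ℕ) :
    ∑ x : OuterPart n L N, weight (outer N x) = mass N (N + 1) := by
  have : Nonempty (OuterPart n L N) := ⟨fun i => ⟨0, hn i.1⟩⟩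
  have h : (Fintype.card (OuterPart n L N) : ℝ) ≠ 0 := by
    exact_mod_cast Fintype.card_ne_zero
  simp only [weight_outer, Finset.sum_const, Finset.card_univ, nsmul_eq_mul]
  field_simp

theorem compSum_shell (hn : ∀ l, 0 < n l) {N : ℕ} (hL : 0 < L N) (c : ℕ → ℝ) :
    compSum N (fun z : TestSpace n L => c (shell z))
      = ∑ l ∈ Finset.range (N + 2), mass N l * c l := by
  rw [Finset.sum_range_succ, ← sum_weight_inner_shell hn hL, ← sum_weight_outer hn (L := L),
    Finset.sum_mul]
  rfl

theorem sum_range_mass_le (N K : ℕ) : ∑ l ∈ Finset.range K, mass N l ≤ mass N K := by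
  have h : ∀ l, mass N l = 2 ^ l * (2 : ℝ) ^ (-((N : ℝ) + 2) ^ 2) := fun l => by
    unfold mass
    rw [sub_eq_add_neg, Real.rpow_add two_pos, Real.rpow_natCast]
  simp only [h, ← Finset.sum_mul]
  refine mul_le_mul_of_nonneg_right ?_ (by positivity)
  rw [geom_sum_eq (by norm_num)]
  norm_num

theorem mass_succ (N l : ℕ) : mass N (l + 1) = 2 * mass N l := by
  unfold mass
  push_cast
  rw [show (l : ℝ) + 1 - ((N : ℝ) + 2) ^ 2 = 1 + (l - ((N : ℝ) + 2) ^ 2) by ring,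
    Real.rpow_add two_pos, Real.rpow_one]

theorem vol_comp_le (hn : ∀ l, 0 < n l) {N : ℕ} (hL : 0 < L N) :
    vol {z : TestSpace n L | comp z = N} ≤ ENNReal.ofReal (2 * mass N (N + 1)) := by
  rw [← setLIntegral_one]
  have := setLIntegral_comp (n := n) (L := L) N (F := fun _ => 1) (fun _ => zero_le_one)
  simp only [ENNReal.ofReal_one] at this
  rw [this, compSum_shell hn hL fun _ => 1]
  refine ENNReal.ofReal_le_ofReal ?_
  simp only [mul_one]
  exact (sum_range_mass_le _ _).trans_eq (mass_succ _ _)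

/-- The top inner shell alone has half the mass of the outer part, so a set containing the inner
part is comparable to the whole component. -/
theorem ofReal_mass_le_vol (hn : ∀ l, 0 < n l) {N : ℕ} (hL : 0 < L N) {A : Set (TestSpace n L)}
    (hA : ∀ y : InnerPart n L N, inner N y ∈ A) : ENNReal.ofReal (mass N N) ≤ vol A := by
  set B : Set (TestSpace n L) := range (inner N) with hB
  have hBA : B ⊆ A := range_subset_iff.2 hA
  refine le_trans ?_ (measure_mono hBA)
  rw [← setLIntegral_one, setLIntegral_vol_of_subset_comp (N := N) (by rintro _ ⟨y, rfl⟩; rfl)]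
  refine le_trans ?_ (le_add_right le_rfl)
  have h1 : ∀ y : InnerPart n L N, B.indicator (fun _ => (1 : ℝ≥0∞)) (inner N y) = 1 := fun y =>
    indicator_of_mem (mem_range_self y) _
  simp only [h1, mul_one]
  rw [← ENNReal.ofReal_sum_of_nonneg (fun _ _ => weight_nonneg _)]
  refine ENNReal.ofReal_le_ofReal ?_
  have := sum_weight_inner_shell hn hL fun _ => 1
  simp only [mul_one] at this
  rw [this]
  exact Finset.single_le_sum (f := mass N) (fun l _ => (mass_pos N l).le)
    (Finset.mem_range.2 (Nat.lt_succ_self N))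

theorem vol_range_outer (hn : ∀ l, 0 < n l) (N : ℕ) :
    vol (range (outer (n := n) (L := L) N)) = ENNReal.ofReal (mass N (N + 1)) := by
  rw [← setLIntegral_one, setLIntegral_vol_of_subset_comp (N := N) (by rintro _ ⟨y, rfl⟩; rfl)]
  have h1 : ∀ y : InnerPart n L N, (range (outer (n := n) (L := L) N)).indicator
      (fun _ => (1 : ℝ≥0∞)) (inner N y) = 0 := fun y =>
    indicator_of_notMem (by rintro ⟨x, hx⟩; exact inner_ne_outer _ _ _ _ hx.symm) _
  have h2 : ∀ x : OuterPart n L N, (range (outer (n := n) (L := L) N)).indicator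
      (fun _ => (1 : ℝ≥0∞)) (outer N x) = 1 := fun x =>
    indicator_of_mem (mem_range_self x) _
  simp only [h1, h2, mul_one, mul_zero, Finset.sum_const_zero, zero_add]
  rw [← ENNReal.ofReal_sum_of_nonneg (fun _ _ => weight_nonneg _), sum_weight_outer hn]

theorem shell_le (z : TestSpace n L) : shell z ≤ comp z + 1 := by
  rcases cases z with ⟨N, y, rfl⟩ | ⟨N, x, rfl⟩
  · exact y.1.1.2.le
  · exact le_rfl

/-- Component N uses exponents between (N + 2)² - (N + 1) and (N + 2)². These ranges are disjoint
for different N, as (N + 2)² - (N + 1) exceeds (N + 1)². -/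
theorem comp_eq_of_level_eq {z w : TestSpace n L} (h : level z = level w) :
    comp z = comp w ∧ shell z = shell w := by
  have h1 := shell_le z
  have h2 := shell_le w
  unfold level at h
  have key : ∀ {N M k l : ℕ}, k ≤ N + 1 → l ≤ M + 1 → (N + 2) ^ 2 - k = (M + 2) ^ 2 - l →
      ¬ N < M := by
    intro N M k l hk hl hkl hNM
    have h3 : (N + 2) ^ 2 ≤ (M + 1) ^ 2 := Nat.pow_le_pow_left (by omega) 2
    have h4 : (M + 2) ^ 2 = (M + 1) ^ 2 + 2 * M + 3 := by ring
    omega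
  have hc : comp z = comp w :=
    le_antisymm (not_lt.1 (key h2 h1 h.symm)) (not_lt.1 (key h1 h2 h))
  refine ⟨hc, ?_⟩
  rw [hc] at h h1
  have h4 : (comp w + 2) ^ 2 = (comp w + 1) ^ 2 + 2 * comp w + 3 := by ring
  omega

theorem mass_shell (z : TestSpace n L) : mass (comp z) (shell z) = (2 : ℝ) ^ (-(level z : ℝ)) := by
  have h1 := shell_le z
  unfold level mass
  rw [Nat.cast_sub (by nlinarith)]
  push_cast
  congr 1
  ring

/-- A nonempty level set is a single shell or a single outer part, of mass exactly 2^(-j). -/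
theorem vol_level_le (hn : ∀ l, 0 < n l) (hL : ∀ N, 0 < L N) (j : ℕ) :
    vol {z : TestSpace n L | level z = j} ≤ ENNReal.ofReal ((2 : ℝ) ^ (-(j : ℝ))) := by
  rcases ({z : TestSpace n L | level z = j}).eq_empty_or_nonempty with h | ⟨z, rfl⟩
  · rw [h, measure_empty]; exact zero_le
  rw [← mass_shell]
  calc vol {w : TestSpace n L | level w = level z}
      ≤ ∫⁻ w in {w : TestSpace n L | comp w = comp z},
          ENNReal.ofReal ((fun l => if l = shell z then 1 else 0) (shell w)) ∂vol := by
        rw [← lintegral_indicator MeasurableSet.of_discrete, ← lintegral_indicator_one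
          MeasurableSet.of_discrete]
        refine lintegral_mono fun w => ?_
        by_cases hw : level w = level z
        · obtain ⟨h1, h2⟩ := comp_eq_of_level_eq hw
          rw [indicator_of_mem (by exact hw), indicator_of_mem (by exact h1)]
          simp [h2]
        · rw [indicator_of_notMem (by exact hw)]
          exact zero_le
    _ = ENNReal.ofReal (mass (comp z) (shell z)) := by
        rw [setLIntegral_comp _ (fun w => by dsimp only; split_ifs <;> norm_num),
          compSum_shell hn (hL _) fun l => if l = shell z then 1 else 0]
        congr 1
        have := shell_le z
        simp
        omega

theorem vol_univ_lt_top (hn : ∀ l, 0 < n l) (hL : ∀ N, 0 < L N) :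
    vol (univ : Set (TestSpace n L)) < ∞ := by
  have hu : (univ : Set (TestSpace n L)) = ⋃ j : ℕ, {z | level z = j} := by
    ext z; simp
  rw [hu]
  refine (measure_iUnion_le _).trans_lt ((ENNReal.tsum_le_tsum fun j =>
    vol_level_le hn hL j).trans_lt ?_)
  have e : ∀ j : ℕ, (2 : ℝ) ^ (-(j : ℝ)) = (1 / 2) ^ j := fun j => by
    rw [Real.rpow_neg (by norm_num), one_div, inv_pow, ← Real.rpow_natCast]
  simp only [e]
  rw [← ENNReal.ofReal_tsum_of_nonneg (fun j => by positivity) summable_geometric_two]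
  exact ENNReal.ofReal_lt_top

/-- The power `1 / p - 1` of the mass of the shell of a point, where `a = 1 / p`. -/
noncomputable def dualWeight (a : ℝ) (z : TestSpace n L) : ℝ := (2 : ℝ) ^ ((level z : ℝ) * (1 - a))

theorem dualWeight_eq (a : ℝ) (z : TestSpace n L) :
    dualWeight a z = mass (comp z) (shell z) ^ (a - 1) := by
  rw [mass_shell, ← Real.rpow_mul (by norm_num)]
  unfold dualWeight
  congr 1
  ring

theorem one_le_dualWeight {a : ℝ} (ha : a < 1) (z : TestSpace n L) : 1 ≤ dualWeight a z :=
  Real.one_le_rpow (by norm_num) (mul_nonneg (by positivity) (by linarith))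

/-- On level j the weight is constant, and the part of A there has measure at most min(2^(-j),
μ(A)). The hypothesis `hK` is the resulting dyadic sum. -/
theorem setLIntegral_dualWeight_le (hn : ∀ l, 0 < n l) (hL : ∀ N, 0 < L N) {a : ℝ}
    {K : ℝ≥0∞} (hK : ∀ u : ℝ≥0∞, ∑' j : ℕ, ENNReal.ofReal ((2 : ℝ) ^ ((j : ℝ) * (1 - a)))
        * min (ENNReal.ofReal ((2 : ℝ) ^ (-(j : ℝ)))) u ≤ K * u ^ a) (A : Set (TestSpace n L)) :
    ∫⁻ z in A, ENNReal.ofReal (dualWeight a z) ∂vol ≤ K * vol A ^ a := by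
  have hu : A = ⋃ j : ℕ, A ∩ {z | level z = j} := by
    ext z; simp
  refine le_trans ?_ (hK (vol A))
  conv_lhs => rw [hu]
  refine (lintegral_iUnion_le _ _).trans (ENNReal.tsum_le_tsum fun j => ?_)
  calc ∫⁻ z in A ∩ {z | level z = j}, ENNReal.ofReal (dualWeight a z) ∂vol
      = ∫⁻ z in A ∩ {z | level z = j}, ENNReal.ofReal ((2 : ℝ) ^ ((j : ℝ) * (1 - a))) ∂vol := by
        refine setLIntegral_congr_fun MeasurableSet.of_discrete fun z hz => ?_
        have : level z = j := hz.2
        unfold dualWeight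
        rw [this]
    _ = ENNReal.ofReal ((2 : ℝ) ^ ((j : ℝ) * (1 - a))) * vol (A ∩ {z | level z = j}) :=
        setLIntegral_const _ _
    _ ≤ _ := mul_le_mul_right (le_min ((measure_mono inter_subset_right).trans
        (vol_level_le hn hL j)) (measure_mono inter_subset_left)) _

end TestSpace

end TestMeasure

/-! ### Pointwise bound for the maximal function. -/

section MaximalBound

variable {n L : ℕ → ℕ}

namespace TestSpace

/-- The mass of an inner point in the group `i`. -/
noncomputable def linkMass (n L : ℕ → ℕ) (N : ℕ) (i : GroupIndex L N) : ℝ :=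
  mass N i.1 / (L N * n i.1)

/-- The total mass of the inner points linked with an outer point. -/
noncomputable def totalLinkMass (n L : ℕ → ℕ) (N : ℕ) : ℝ := ∑ i, linkMass n L N i

/-- The normalised masses of the inner points linked with an outer point. -/
noncomputable def linkCoeff (n L : ℕ → ℕ) (N : ℕ) (i : GroupIndex L N) : ℝ :=
  linkMass n L N i / totalLinkMass n L N

/-- The mean of a function over a group. -/
noncomputable def groupMean (F : TestSpace n L → ℝ) (N : ℕ) (i : GroupIndex L N) : ℝ :=
  (∑ j, F (inner N ⟨i, j⟩)) / n i.1

/-- The deviation of the average over the linked points from its mean value. -/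
noncomputable def deviation (F : TestSpace n L → ℝ) (N : ℕ) (x : OuterPart n L N) : ℝ :=
  ∑ i, linkCoeff n L N i * (F (inner N ⟨i, x i⟩) - groupMean F N i)

theorem linkMass_nonneg (N : ℕ) (i : GroupIndex L N) : 0 ≤ linkMass n L N i := by
  have := mass_pos N i.1
  unfold linkMass
  positivity

theorem totalLinkMass_nonneg (N : ℕ) : 0 ≤ totalLinkMass n L N :=
  Finset.sum_nonneg fun _ _ => linkMass_nonneg _ _

theorem linkCoeff_nonneg (N : ℕ) (i : GroupIndex L N) : 0 ≤ linkCoeff n L N i :=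
  div_nonneg (linkMass_nonneg _ _) (totalLinkMass_nonneg _)

theorem sum_linkMass_mul {N : ℕ} (hL : 0 < L N) (c : ℕ → ℝ) :
    ∑ i, linkMass n L N i * c i.1 = ∑ l ∈ Finset.range (N + 1), mass N l / n l * c l := by
  unfold linkMass
  rw [Fintype.sum_prod_type, ← Fin.sum_univ_eq_sum_range (fun l => mass N l / n l * c l)]
  refine Finset.sum_congr rfl fun l _ => ?_
  have h2 : (L N : ℝ) ≠ 0 := by exact_mod_cast hL.ne'
  simp only [Finset.sum_const, Finset.card_univ, Fintype.card_fin, nsmul_eq_mul]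
  field_simp

theorem totalLinkMass_eq {N : ℕ} (hL : 0 < L N) :
    totalLinkMass n L N = ∑ l ∈ Finset.range (N + 1), mass N l / n l := by
  simpa [totalLinkMass] using sum_linkMass_mul (n := n) hL fun _ => 1

theorem totalLinkMass_pos (hn : ∀ l, 0 < n l) {N : ℕ} (hL : 0 < L N) :
    0 < totalLinkMass n L N := by
  rw [totalLinkMass_eq hL]
  refine Finset.sum_pos (fun l _ => ?_) ⟨0, by simp⟩
  have := mass_pos N l
  have := hn l
  positivity

theorem sum_linkCoeff (hn : ∀ l, 0 < n l) {N : ℕ} (hL : 0 < L N) :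
    ∑ i, linkCoeff n L N i = 1 := by
  unfold linkCoeff
  rw [← Finset.sum_div]
  exact div_self (totalLinkMass_pos hn hL).ne'

theorem mass_rpow (N l : ℕ) (c : ℝ) :
    mass N l ^ c = (2 : ℝ) ^ (((l : ℝ) - ((N : ℝ) + 2) ^ 2) * c) := by
  unfold mass
  rw [← Real.rpow_mul (by norm_num)]

theorem mass_div_le {a : ℝ} (hn1 : ∀ l : ℕ, (2 : ℝ) ^ ((l : ℝ) * (1 - a)) ≤ n l) (N l : ℕ) :
    mass N l / n l ≤ (2 : ℝ) ^ (l * a - ((N : ℝ) + 2) ^ 2) := by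
  have h0 : (0 : ℝ) < (2 : ℝ) ^ ((l : ℝ) * (1 - a)) := by positivity
  refine (div_le_div_of_nonneg_left (mass_pos N l).le h0 (hn1 l)).trans_eq ?_
  unfold mass
  rw [← Real.rpow_sub two_pos]
  congr 1
  ring

theorem le_mass_div {a : ℝ} (hn : ∀ l, 0 < n l)
    (hn2 : ∀ l : ℕ, (n l : ℝ) ≤ 2 * (2 : ℝ) ^ ((l : ℝ) * (1 - a))) (N l : ℕ) :
    (2 : ℝ) ^ (l * a - ((N : ℝ) + 2) ^ 2 - 1) ≤ mass N l / n l := by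
  have h0 : (0 : ℝ) < n l := by exact_mod_cast hn l
  refine Eq.trans_le ?_ (div_le_div_of_nonneg_left (mass_pos N l).le h0 (hn2 l))
  unfold mass
  rw [mul_comm (2 : ℝ), ← div_div, ← Real.rpow_sub two_pos, ← Real.rpow_sub_one (by norm_num)]
  congr 1
  ring

/-- The size of n l makes the chosen mass in shell l about 2^(la), and the total is at least the
term l = N. One factor 2 comes from rounding n l, another from 2^a ≤ 2 in passing from N to N + 1.
-/
theorem linkCoeff_le {a : ℝ} (ha1 : a < 1) (hn : ∀ l, 0 < n l)
    (hn1 : ∀ l : ℕ, (2 : ℝ) ^ ((l : ℝ) * (1 - a)) ≤ n l)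
    (hn2 : ∀ l : ℕ, (n l : ℝ) ≤ 2 * (2 : ℝ) ^ ((l : ℝ) * (1 - a))) {N : ℕ} (hL : 0 < L N)
    (i : GroupIndex L N) :
    linkCoeff n L N i ≤ 4 * mass N (N + 1) ^ (-a) * (mass N i.1 ^ a / L N) := by
  have hL' : (0 : ℝ) < L N := by exact_mod_cast hL
  have h1 : linkMass n L N i ≤ (2 : ℝ) ^ ((i.1 : ℕ) * a - ((N : ℝ) + 2) ^ 2) / L N := by
    unfold linkMass
    rw [mul_comm, ← div_div]
    exact div_le_div_of_nonneg_right (mass_div_le hn1 N i.1) hL'.le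
  have h2 : (2 : ℝ) ^ (N * a - ((N : ℝ) + 2) ^ 2 - 1) ≤ totalLinkMass n L N := by
    rw [totalLinkMass_eq hL]
    refine (le_mass_div hn hn2 N N).trans (Finset.single_le_sum
      (f := fun l => mass N l / n l) (fun l _ => ?_) (Finset.mem_range.2 (Nat.lt_succ_self N)))
    have := mass_pos N l
    positivity
  calc linkCoeff n L N i
      ≤ ((2 : ℝ) ^ ((i.1 : ℕ) * a - ((N : ℝ) + 2) ^ 2) / L N)
          / (2 : ℝ) ^ (N * a - ((N : ℝ) + 2) ^ 2 - 1) :=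
        div_le_div₀ (by positivity) h1 (by positivity) h2
    _ = (2 : ℝ) ^ (((i.1 : ℕ) - N) * a + 1) / L N := by
        rw [div_right_comm, ← Real.rpow_sub two_pos]
        congr 2
        ring
    _ ≤ (2 : ℝ) ^ (2 + ((i.1 : ℕ) - ((N + 1 : ℕ) : ℝ)) * a) / L N := by
        refine div_le_div_of_nonneg_right (Real.rpow_le_rpow_of_exponent_le (by norm_num) ?_) hL'.le
        push_cast
        linarith
    _ = _ := by
        rw [mass_rpow, mass_rpow, mul_div_assoc', mul_assoc, ← Real.rpow_add two_pos,
          Real.rpow_add two_pos 2]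
        norm_num
        congr 2
        ring_nf

theorem compSum_dualWeight_eq (hn : ∀ l, 0 < n l) (a : ℝ) (N : ℕ) (F : TestSpace n L → ℝ) :
    ∑ y : InnerPart n L N, weight (inner N y) * (dualWeight a (inner N y) * F (inner N y))
      = ∑ i : GroupIndex L N, mass N i.1 ^ a / L N * groupMean F N i := by
  rw [sum_weight_inner hn N fun y => dualWeight a (inner N y) * F (inner N y)]
  refine Finset.sum_congr rfl fun i _ => ?_
  have e : ∀ j, dualWeight a (inner N ⟨i, j⟩ : TestSpace n L) = mass N i.1 ^ (a - 1) := fun j =>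
    dualWeight_eq a _
  simp only [e, ← Finset.mul_sum]
  unfold groupMean
  rw [Real.rpow_sub_one (mass_pos _ _).ne']
  have := (mass_pos N i.1).ne'
  field_simp

theorem groupMean_nonneg {F : TestSpace n L → ℝ} (hF : ∀ z, 0 ≤ F z) (N : ℕ)
    (i : GroupIndex L N) : 0 ≤ groupMean F N i :=
  div_nonneg (Finset.sum_nonneg fun _ _ => hF _) (by positivity)

theorem dualWeight_nonneg (a : ℝ) (z : TestSpace n L) : 0 ≤ dualWeight a z := by
  unfold dualWeight; positivity

/-- The mean part of a linked average is, up to constants, the pairing with the dual weight: this is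
the reason for the choice of n l. -/
theorem sum_linkCoeff_mul_groupMean_le {a : ℝ} (ha1 : a < 1) (hn : ∀ l, 0 < n l)
    (hn1 : ∀ l : ℕ, (2 : ℝ) ^ ((l : ℝ) * (1 - a)) ≤ n l)
    (hn2 : ∀ l : ℕ, (n l : ℝ) ≤ 2 * (2 : ℝ) ^ ((l : ℝ) * (1 - a))) {N : ℕ} (hL : 0 < L N)
    {F : TestSpace n L → ℝ} (hF : ∀ z, 0 ≤ F z) :
    ∑ i, linkCoeff n L N i * groupMean F N i
      ≤ 4 * mass N (N + 1) ^ (-a) * compSum N fun z => dualWeight a z * F z := by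
  have h1 : ∑ i, linkCoeff n L N i * groupMean F N i ≤ 4 * mass N (N + 1) ^ (-a) *
      ∑ i : GroupIndex L N, mass N i.1 ^ a / L N * groupMean F N i := by
    rw [Finset.mul_sum]
    refine Finset.sum_le_sum fun i _ => ?_
    rw [← mul_assoc]
    exact mul_le_mul_of_nonneg_right (linkCoeff_le ha1 hn hn1 hn2 hL i) (groupMean_nonneg hF N i)
  refine h1.trans ?_
  rw [← compSum_dualWeight_eq hn]
  have := mass_pos N (N + 1)
  refine mul_le_mul_of_nonneg_left ?_ (by positivity)
  exact le_add_of_nonneg_right (Finset.sum_nonneg fun _ _ => mul_nonneg (weight_nonneg _)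
    (mul_nonneg (dualWeight_nonneg _ _) (hF _)))

theorem setLIntegral_insert_linked (N : ℕ) (x : OuterPart n L N) {F : TestSpace n L → ℝ}
    (hF : ∀ z, 0 ≤ F z) :
    ∫⁻ z in insert (outer N x) (range fun i => inner N ⟨i, x i⟩), ENNReal.ofReal (F z) ∂vol
      = ENNReal.ofReal (weight (outer N x) * F (outer N x)
        + ∑ i, linkMass n L N i * F (inner N ⟨i, x i⟩)) := by
  classical
  set A : Set (TestSpace n L) := insert (outer N x) (range fun i => inner N ⟨i, x i⟩) with hA
  rw [setLIntegral_vol_of_subset_comp (N := N) (by rintro _ (rfl | ⟨i, rfl⟩) <;> rfl)]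
  have h1 : ∀ i j, A.indicator (fun z => ENNReal.ofReal (F z)) (inner N ⟨i, j⟩)
      = if x i = j then ENNReal.ofReal (F (inner N ⟨i, x i⟩)) else 0 := by
    intro i j
    split_ifs with h
    · subst h
      exact indicator_of_mem (s := A) (mem_insert_of_mem _ (mem_range_self i)) _
    · refine indicator_of_notMem ?_ _
      rintro (h' | ⟨k, hk⟩)
      · exact inner_ne_outer _ _ _ _ h'
      · have h2 := inner_injective N hk
        obtain rfl : k = i := congrArg Sigma.fst h2
        exact h (eq_of_heq (Sigma.mk.inj h2).2)
  have h2 : ∀ x', A.indicator (fun z => ENNReal.ofReal (F z)) (outer N x')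
      = if x = x' then ENNReal.ofReal (F (outer N x)) else 0 := by
    intro x'
    split_ifs with h
    · subst h
      exact indicator_of_mem (s := A) (mem_insert _ _) _
    · refine indicator_of_notMem ?_ _
      rintro (h' | ⟨k, hk⟩)
      · exact h (outer_injective N h').symm
      · exact inner_ne_outer _ _ _ _ hk
  rw [Fintype.sum_sigma]
  simp only [h1, h2, mul_ite, mul_zero, Finset.sum_ite_eq, Finset.mem_univ, if_true]
  rw [add_comm, ENNReal.ofReal_add (mul_nonneg (weight_nonneg _) (hF _)) (Finset.sum_nonneg
    fun i _ => mul_nonneg (linkMass_nonneg _ _) (hF _)), ENNReal.ofReal_mul (weight_nonneg _),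
    ENNReal.ofReal_sum_of_nonneg fun i _ => mul_nonneg (linkMass_nonneg _ _) (hF _)]
  simp only [ENNReal.ofReal_mul (linkMass_nonneg _ _)]
  rfl

theorem vol_insert_linked (N : ℕ) (x : OuterPart n L N) :
    vol (insert (outer N x) (range fun i => inner N ⟨i, x i⟩))
      = ENNReal.ofReal (weight (outer N x) + totalLinkMass n L N) := by
  have := setLIntegral_insert_linked N x (F := fun _ => 1) fun _ => zero_le_one
  simp only [ENNReal.ofReal_one, setLIntegral_one, mul_one] at this
  exact this

/-- The average over the linked ball is a convex combination of the value at the centre and the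
weighted average over the chosen atoms, which is mean plus deviation. -/
theorem average_insert_linked_le {a : ℝ} (ha1 : a < 1) (hn : ∀ l, 0 < n l)
    (hn1 : ∀ l : ℕ, (2 : ℝ) ^ ((l : ℝ) * (1 - a)) ≤ n l)
    (hn2 : ∀ l : ℕ, (n l : ℝ) ≤ 2 * (2 : ℝ) ^ ((l : ℝ) * (1 - a))) {N : ℕ} (hL : 0 < L N)
    {F : TestSpace n L → ℝ} (hF : ∀ z, 0 ≤ F z) (x : OuterPart n L N) :
    (weight (outer N x) * F (outer N x) + ∑ i, linkMass n L N i * F (inner N ⟨i, x i⟩))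
      / (weight (outer N x) + totalLinkMass n L N)
      ≤ F (outer N x) + 4 * mass N (N + 1) ^ (-a) * (compSum N fun z => dualWeight a z * F z)
        + |deviation F N x| := by
  have hB := totalLinkMass_pos hn hL
  have hw := weight_nonneg (outer N x)
  have e : ∑ i, linkMass n L N i * F (inner N ⟨i, x i⟩)
      = totalLinkMass n L N * (∑ i, linkCoeff n L N i * groupMean F N i + deviation F N x) := by
    unfold deviation
    rw [← Finset.sum_add_distrib, Finset.mul_sum]
    refine Finset.sum_congr rfl fun i _ => ?_
    unfold linkCoeff
    field_simp
    ring
  have h1 := sum_linkCoeff_mul_groupMean_le ha1 hn hn1 hn2 hL hF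
  have h2 := le_abs_self (deviation F N x)
  have h3 : 0 ≤ 4 * mass N (N + 1) ^ (-a) * (compSum N fun z => dualWeight a z * F z) := by
    have := mass_pos N (N + 1)
    have := compSum_nonneg N fun z => mul_nonneg (dualWeight_nonneg a z) (hF z)
    positivity
  have h4 := abs_nonneg (deviation F N x)
  rw [div_le_iff₀ (by linarith), e]
  have h5 : totalLinkMass n L N * (∑ i, linkCoeff n L N i * groupMean F N i + deviation F N x)
      ≤ totalLinkMass n L N * (4 * mass N (N + 1) ^ (-a) *
        (compSum N fun z => dualWeight a z * F z) + |deviation F N x|) :=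
    mul_le_mul_of_nonneg_left (by linarith) hB.le
  have h6 := mul_nonneg hw (add_nonneg h3 h4)
  have h7 := mul_nonneg hB.le (hF (outer N x))
  linarith

/-- No shell of the component is heavier than the outer part and a < 1, so the dual weight is at
least m^(a-1) and the plain integral is dominated by the weighted one. -/
theorem setLIntegral_div_le_of_subset_comp {a : ℝ} (ha1 : a < 1) (hn : ∀ l, 0 < n l) {N : ℕ}
    (hL : 0 < L N) {F : TestSpace n L → ℝ} (hF : ∀ z, 0 ≤ F z) {A : Set (TestSpace n L)}
    (hA : A ⊆ {z | comp z = N}) (hA' : ∀ y : InnerPart n L N, inner N y ∈ A) :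
    (∫⁻ z in A, ENNReal.ofReal (F z) ∂vol) / vol A
      ≤ ENNReal.ofReal
        (4 * mass N (N + 1) ^ (-a) * compSum N fun z => dualWeight a z * F z) := by
  have hm := mass_pos N (N + 1)
  have hmN := mass_pos N N
  refine (ENNReal.div_le_div (lintegral_mono_set hA) (ofReal_mass_le_vol hn hL hA')).trans ?_
  rw [setLIntegral_comp N hF, ← ENNReal.ofReal_div_of_pos hmN]
  refine ENNReal.ofReal_le_ofReal ?_
  have h1 : compSum N F ≤ mass N (N + 1) ^ (1 - a) * compSum N fun z => dualWeight a z * F z := by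
    have key : ∀ z : TestSpace n L, comp z = N →
        weight z * F z ≤ mass N (N + 1) ^ (1 - a) * (weight z * (dualWeight a z * F z)) := by
      rintro z rfl
      have h2 : 1 ≤ mass (comp z) (comp z + 1) ^ (1 - a) * dualWeight a z := by
        rw [dualWeight_eq, mass_rpow, mass_rpow, ← Real.rpow_add two_pos]
        refine Real.one_le_rpow (by norm_num) ?_
        have h3 : (shell z : ℝ) ≤ ((comp z + 1 : ℕ) : ℝ) := by exact_mod_cast shell_le z
        nlinarith
      calc weight z * F z = 1 * (weight z * F z) := (one_mul _).symm
        _ ≤ (mass (comp z) (comp z + 1) ^ (1 - a) * dualWeight a z) * (weight z * F z) :=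
            mul_le_mul_of_nonneg_right h2 (mul_nonneg (weight_nonneg _) (hF _))
        _ = _ := by ring
    unfold compSum
    rw [mul_add, Finset.mul_sum, Finset.mul_sum]
    exact add_le_add (Finset.sum_le_sum fun y _ => key _ rfl)
      (Finset.sum_le_sum fun x _ => key _ rfl)
  have h0 := compSum_nonneg N fun z => mul_nonneg (dualWeight_nonneg a z) (hF z)
  rw [div_le_iff₀ hmN]
  refine h1.trans ?_
  have e : mass N (N + 1) ^ (1 - a) = 2 * mass N (N + 1) ^ (-a) * mass N N := by
    rw [sub_eq_add_neg, Real.rpow_add hm, Real.rpow_one, mass_succ]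
    ring
  rw [e]
  have h4 : 0 ≤ mass N (N + 1) ^ (-a) * mass N N
      * compSum N fun z => dualWeight a z * F z := by positivity
  linarith

/-- The deviation as a function on the whole space. -/
noncomputable def deviationFun (F : TestSpace n L → ℝ) : TestSpace n L → ℝ≥0∞
  | ⟨_, Sum.inl _⟩ => 0
  | ⟨N, Sum.inr x⟩ => ENNReal.ofReal |deviation F N x|

/-- The pointwise bound for the maximal function. -/
theorem centeredMaximal_le {a : ℝ} (ha1 : a < 1) (hn : ∀ l, 0 < n l)
    (hn1 : ∀ l : ℕ, (2 : ℝ) ^ ((l : ℝ) * (1 - a)) ≤ n l)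
    (hn2 : ∀ l : ℕ, (n l : ℝ) ≤ 2 * (2 : ℝ) ^ ((l : ℝ) * (1 - a))) (hL : ∀ N, 0 < L N)
    (f : TestSpace n L → ℂ) (z : TestSpace n L) :
    centeredMaximal vol f z ≤ ENNReal.ofReal ‖f z‖
      + ((∫⁻ z, ENNReal.ofReal ‖f z‖ ∂vol) / vol (univ : Set (TestSpace n L))
      + (ENNReal.ofReal (4 * mass (comp z) (comp z + 1) ^ (-a)
          * compSum (comp z) fun z => dualWeight a z * ‖f z‖)
      + deviationFun (fun z => ‖f z‖) z)) := by
  have hF : ∀ z, 0 ≤ ‖f z‖ := fun z => norm_nonneg _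
  have hsingle : (∫⁻ w in {z}, ENNReal.ofReal ‖f w‖ ∂vol) / vol {z} = ENNReal.ofReal ‖f z‖ := by
    rw [lintegral_singleton, vol_singleton]
    exact ENNReal.mul_div_cancel_right
      (by simpa using weight_pos hn hL z) ENNReal.ofReal_ne_top
  unfold centeredMaximal
  simp only [← ofReal_norm]
  refine iSup₂_le fun s hs => ?_
  obtain ⟨hs0, -, -⟩ := hs
  -- The summands absorb, in order, singletons, the whole space, balls containing the inner part of
  -- a component, and the fluctuation over linked balls.
  rcases lt_or_ge 3 s with h3 | h3
  · rw [ball_eq_univ h3, Measure.restrict_univ]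
    exact le_add_left (le_add_right le_rfl)
  rcases le_or_gt s 1 with h1 | h1
  · rw [ball_eq_singleton hs0 h1, hsingle]
    exact le_add_right le_rfl
  rcases cases z with ⟨N, y, rfl⟩ | ⟨N, x, rfl⟩
  · refine (setLIntegral_div_le_of_subset_comp ha1 hn (hL N) hF (ball_subset_comp h3)
      fun y' => inner_mem_ball_inner h1).trans ?_
    exact le_add_left (le_add_left (le_add_right le_rfl))
  rcases le_or_gt s (3 / 2) with h2 | h2
  · rw [ball_outer_eq_singleton hs0 h2, hsingle]
    exact le_add_right le_rfl
  rcases lt_or_ge 2 s with h4 | h4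
  · refine (setLIntegral_div_le_of_subset_comp ha1 hn (hL N) hF (ball_subset_comp h3)
      fun y' => comp_subset_ball h4 (by exact rfl)).trans ?_
    exact le_add_left (le_add_left (le_add_right le_rfl))
  rw [ball_outer_eq h2 h4, setLIntegral_insert_linked N x hF, vol_insert_linked,
    ← ENNReal.ofReal_div_of_pos (add_pos_of_nonneg_of_pos (weight_nonneg _)
      (totalLinkMass_pos hn (hL N)))]
  have hm := mass_pos N (N + 1)
  have h0 := compSum_nonneg N fun z => mul_nonneg (dualWeight_nonneg a z) (hF z)
  refine (ENNReal.ofReal_le_ofReal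
    (average_insert_linked_le ha1 hn hn1 hn2 (hL N) hF x)).trans ?_
  rw [ENNReal.ofReal_add (by positivity) (abs_nonneg _), ENNReal.ofReal_add (hF _) (by positivity),
    add_assoc]
  exact add_le_add le_rfl (le_add_left le_rfl)

end TestSpace

end MaximalBound

/-! ### The deviation is small when the groups are many. -/

section Bounded

variable {n L : ℕ → ℕ}

namespace TestSpace

/-- Values and group means both lie in [0, H], and the coefficients sum to 1. -/
theorem abs_deviation_le (hn : ∀ l, 0 < n l) {N : ℕ} (hL : 0 < L N) {F : TestSpace n L → ℝ}
    (hF : ∀ z, 0 ≤ F z) {H : ℝ} (hH : ∀ y : InnerPart n L N, F (inner N y) ≤ H)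
    (x : OuterPart n L N) : |deviation F N x| ≤ H := by
  unfold deviation
  refine (Finset.abs_sum_le_sum_abs _ _).trans ?_
  rw [← one_mul H, ← sum_linkCoeff hn hL, Finset.sum_mul]
  refine Finset.sum_le_sum fun i _ => ?_
  rw [abs_mul, abs_of_nonneg (linkCoeff_nonneg N i)]
  refine mul_le_mul_of_nonneg_left ?_ (linkCoeff_nonneg N i)
  have h1 : groupMean F N i ≤ H := by
    unfold groupMean
    have h0 : (0 : ℝ) < n i.1 := by exact_mod_cast hn i.1
    rw [div_le_iff₀ h0]
    refine (Finset.sum_le_card_nsmul _ _ H fun j _ => hH _).trans_eq ?_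
    simp [mul_comm]
  have h2 := groupMean_nonneg hF N i
  have h3 := hF (inner N ⟨i, x i⟩)
  have h4 := hH ⟨i, x i⟩
  rw [abs_le]
  constructor <;> linarith

/-- The coordinates are independent, so the variance is at most the mean of ∑ (coefficient · F)².
One factor of each square is bounded by c · H and the other gives the mean part again. -/
theorem sum_sq_deviation_le (hn : ∀ l, 0 < n l) {N : ℕ} {F : TestSpace n L → ℝ}
    (hF : ∀ z, 0 ≤ F z) {H c : ℝ} (hH : ∀ y : InnerPart n L N, F (inner N y) ≤ H)
    (hc : ∀ i : GroupIndex L N, linkCoeff n L N i ≤ c) :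
    ∑ x : OuterPart n L N, deviation F N x ^ 2 ≤ Fintype.card (OuterPart n L N)
      * (c * H * ∑ i, linkCoeff n L N i * groupMean F N i) := by
  have h := sum_pi_sq_sum_sub_mean_le (n := fun i : GroupIndex L N => n i.1) (fun i => hn _)
    (fun i j => linkCoeff n L N i * F (inner N ⟨i, j⟩))
  have e : ∀ x : OuterPart n L N, deviation F N x = ∑ i, (linkCoeff n L N i *
      F (inner N ⟨i, x i⟩) - (∑ j, linkCoeff n L N i * F (inner N ⟨i, j⟩)) / n i.1) := by
    intro x
    unfold deviation groupMean
    refine Finset.sum_congr rfl fun i _ => ?_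
    rw [← Finset.mul_sum]
    ring
  simp only [e]
  refine h.trans (mul_le_mul_of_nonneg_left ?_ (by positivity))
  rw [Finset.mul_sum]
  refine Finset.sum_le_sum fun i _ => ?_
  unfold groupMean
  rw [mul_div_assoc', mul_div_assoc']
  refine div_le_div_of_nonneg_right ?_ (by positivity)
  rw [Finset.mul_sum, Finset.mul_sum]
  refine Finset.sum_le_sum fun j _ => ?_
  have h1 := linkCoeff_nonneg (n := n) N i
  have h2 := hF (inner N ⟨i, j⟩)
  have h3 := hH ⟨i, j⟩
  have h4 := hc i
  calc (linkCoeff n L N i * F (inner N ⟨i, j⟩)) ^ 2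
      = linkCoeff n L N i * F (inner N ⟨i, j⟩) *
        (linkCoeff n L N i * F (inner N ⟨i, j⟩)) := by ring
    _ ≤ c * H * (linkCoeff n L N i * F (inner N ⟨i, j⟩)) := by
        refine mul_le_mul_of_nonneg_right ?_ (mul_nonneg h1 h2)
        exact mul_le_mul h4 h3 h2 (h1.trans h4)

/-- The part of the deviation living on the component `N`. -/
noncomputable def deviationComp (F : TestSpace n L → ℝ) (N : ℕ) (z : TestSpace n L) : ℝ≥0∞ :=
  {z | comp z = N}.indicator (deviationFun F) z

theorem vol_deviationComp_le (hn : ∀ l, 0 < n l) {N : ℕ} (F : TestSpace n L → ℝ) {t : ℝ}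
    (ht : 0 < t) {V : ℝ}
    (hV : ∑ x : OuterPart n L N, deviation F N x ^ 2 ≤ Fintype.card (OuterPart n L N) * V) :
    vol {z | ENNReal.ofReal t < deviationComp F N z} ≤ ENNReal.ofReal (mass N (N + 1))
    ∧ vol {z | ENNReal.ofReal t < deviationComp F N z}
      ≤ ENNReal.ofReal (mass N (N + 1) * (V / t ^ 2)) := by
  classical
  have hsub : {z | ENNReal.ofReal t < deviationComp F N z}
      ⊆ outer N '' {x | t < |deviation F N x|} := by
    intro z hz
    rw [mem_ofPred_eq] at hz
    unfold deviationComp at hz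
    have hc : comp z = N := by
      by_contra h
      rw [indicator_of_notMem (by exact h)] at hz
      exact not_lt_zero hz
    rw [indicator_of_mem (by exact hc)] at hz
    rcases cases z with ⟨M, y, rfl⟩ | ⟨M, x, rfl⟩
    · exact absurd hz not_lt_zero
    · obtain rfl : M = N := hc
      exact ⟨x, (ENNReal.ofReal_lt_ofReal_iff_of_nonneg ht.le).1 hz, rfl⟩
  constructor
  · rw [← vol_range_outer hn N (L := L)]
    exact measure_mono (hsub.trans (image_subset_range _ _))
  · refine (measure_mono hsub).trans ?_
    have : Nonempty (OuterPart n L N) := ⟨fun i => ⟨0, hn i.1⟩⟩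
    have hcard : (0 : ℝ) < Fintype.card (OuterPart n L N) := by
      exact_mod_cast Fintype.card_pos
    have himg : outer N '' {x | t < |deviation F N x|}
        = ⋃ x ∈ Finset.univ.filter fun x => t < |deviation F N x|, {outer N x} := by
      ext z
      simp [eq_comm]
    rw [himg]
    refine (measure_biUnion_finset_le _ _).trans ?_
    simp only [vol_singleton, weight_outer, Finset.sum_const, nsmul_eq_mul]
    rw [← ENNReal.ofReal_natCast, ← ENNReal.ofReal_mul (by positivity)]
    refine ENNReal.ofReal_le_ofReal ?_
    have h1 := (card_filter_lt_abs_mul_sq_le (deviation F N) ht.le).trans hV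
    have hm := mass_pos N (N + 1)
    rw [mul_div_assoc', mul_div_assoc', div_le_div_iff₀ hcard (by positivity)]
    nlinarith [mul_le_mul_of_nonneg_left h1 hm.le]

/-- The rate at which the deviation on the component `N` decays as the groups multiply. -/
noncomputable def deviationRate (a s K : ℝ) (N l : ℕ) : ℝ :=
  (16 * K) ^ s * ((4 : ℝ) ^ (N + 1)) ^ (a * (1 - s)) * (l : ℝ) ^ (a * (1 - s) - s) / (1 - 2 * s)

/-- The hypothesis says that the exponent of l is negative. The resulting choice of L N beats the
growth in N and makes the components summable. -/
theorem exists_deviationRate_le {a s K : ℝ} (has : a * (1 - s) < s) (N : ℕ) :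
    ∃ l : ℕ, 0 < l ∧ deviationRate a s K N l ≤ (1 / 2) ^ N := by
  have h := (tendsto_rpow_neg_atTop (y := s - a * (1 - s)) (by linarith)).comp
    (tendsto_natCast_atTop_atTop (R := ℝ))
  have h2 := (h.const_mul ((16 * K) ^ s * ((4 : ℝ) ^ (N + 1)) ^ (a * (1 - s)))).div_const
    (1 - 2 * s)
  rw [mul_zero, zero_div] at h2
  have h3 : ∀ᶠ l : ℕ in Filter.atTop, deviationRate a s K N l < (1 / 2) ^ N := by
    refine (h2.eventually_lt_const (u := (1 / 2 : ℝ) ^ N) (by positivity)).mono fun l hl => ?_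
    unfold deviationRate
    simpa using hl
  obtain ⟨l, hl1, hl2⟩ := (h3.and (Filter.eventually_gt_atTop 0)).exists
  exact ⟨l, hl2, hl1.le⟩

/-- The height H, read off from the atoms, grows like (L N)^a, while the variance V is of order H /
L N. Interpolating with s gives V^s H^(1-2s), of order (L N)^(a(1-s)-s). -/
theorem lorentzOne_deviationComp_le {p s K Λ : ℝ} (hp : 1 < p) (hs0 : 0 < s) (hs : s < 1 / 2)
    (hsp : s ≤ 1 / p) (hn : ∀ l, 0 < n l)
    (hn1 : ∀ l : ℕ, (2 : ℝ) ^ ((l : ℝ) * (1 - 1 / p)) ≤ n l)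
    (hn2 : ∀ l : ℕ, (n l : ℝ) ≤ 2 * (2 : ℝ) ^ ((l : ℝ) * (1 - 1 / p))) {N : ℕ} (hL : 0 < L N)
    {F : TestSpace n L → ℝ} (hF : ∀ z, 0 ≤ F z) (hK : 0 ≤ K) (hΛ : 0 ≤ Λ)
    (hatom : ∀ z, F z * weight z ^ (1 / p) ≤ Λ)
    (hcomp : (compSum N fun z => dualWeight (1 / p) z * F z) ≤ K * Λ) :
    lorentzOne p vol (deviationComp F N)
      ≤ ENNReal.ofReal (Λ * deviationRate (1 / p) s K N (L N)) := by
  have hp0 : 0 < p := by linarith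
  set a := 1 / p with ha
  have ha0 : 0 < a := by positivity
  have ha1 : a < 1 := by rw [ha, div_lt_one hp0]; exact hp
  have hm := mass_pos N (N + 1)
  set m := mass N (N + 1) with hmdef
  have hL' : (0 : ℝ) < L N := by exact_mod_cast hL
  set H : ℝ := Λ * m ^ (-a) * (L N * 4 ^ (N + 1)) ^ a with hHdef
  have hH0 : 0 ≤ H := by positivity
  have hH : ∀ y : InnerPart n L N, F (inner N y) ≤ H := by
    intro y
    have hnl : (0 : ℝ) < n y.1.1 := by exact_mod_cast hn y.1.1
    have hly : (y.1.1 : ℕ) ≤ N := Nat.lt_succ_iff.1 y.1.1.2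
    -- One factor 2^(N+1) bounds the ratio of m to the shell mass, the other bounds n l.
    have hw : m / (L N * 4 ^ (N + 1)) ≤ weight (inner N y) := by
      rw [weight_inner, div_le_div_iff₀ (by positivity) (by positivity)]
      have h1 : m = 2 ^ (N + 1 - (y.1.1 : ℕ)) * mass N y.1.1 := by
        have : ∀ k l, mass N (l + k) = 2 ^ k * mass N l := by
          intro k l
          induction k with
          | zero => simp
          | succ k ih => rw [← add_assoc, mass_succ, ih]; ring
        rw [← this, Nat.add_sub_cancel' (by omega)]
      have h2 : (n y.1.1 : ℝ) ≤ 2 ^ (N + 1) := by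
        refine (hn2 _).trans ?_
        rw [pow_succ', ← Real.rpow_natCast 2 N]
        gcongr
        · norm_num
        · have : ((y.1.1 : ℕ) : ℝ) ≤ N := by exact_mod_cast hly
          nlinarith [(Nat.cast_nonneg (y.1.1 : ℕ) : (0 : ℝ) ≤ _)]
      have h3 : (2 : ℝ) ^ (N + 1 - (y.1.1 : ℕ)) ≤ 2 ^ (N + 1) :=
        pow_le_pow_right₀ (by norm_num) (Nat.sub_le _ _)
      have h4 : (4 : ℝ) ^ (N + 1) = 2 ^ (N + 1) * 2 ^ (N + 1) := by
        rw [← mul_pow]; norm_num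
      have hml := mass_pos N y.1.1
      rw [h1, h4]
      have h5 : (2 : ℝ) ^ (N + 1 - (y.1.1 : ℕ)) * n y.1.1 ≤ 2 ^ (N + 1) * 2 ^ (N + 1) := by
        gcongr
      have h6 := mul_le_mul_of_nonneg_left h5 (mul_nonneg hml.le hL'.le)
      linarith
    have h1 : F (inner N y) * (m / (L N * 4 ^ (N + 1))) ^ a ≤ Λ :=
      (mul_le_mul_of_nonneg_left (Real.rpow_le_rpow (by positivity) hw ha0.le) (hF _)).trans
        (hatom _)
    rw [Real.div_rpow hm.le (by positivity), mul_div_assoc', div_le_iff₀ (by positivity)] at h1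
    rw [hHdef, Real.rpow_neg hm.le, mul_right_comm, ← div_eq_mul_inv, le_div_iff₀ (by positivity)]
    exact h1
  have hc : ∀ i : GroupIndex L N, linkCoeff n L N i ≤ 4 / L N := by
    intro i
    refine (linkCoeff_le ha1 hn hn1 hn2 hL i).trans ?_
    rw [← hmdef, mul_div_assoc', mul_assoc]
    refine div_le_div_of_nonneg_right ?_ hL'.le
    have h1 : mass N i.1 ^ a ≤ m ^ a := by
      refine Real.rpow_le_rpow (mass_pos _ _).le ?_ ha0.le
      unfold m mass
      refine Real.rpow_le_rpow_of_exponent_le (by norm_num) ?_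
      have : ((i.1 : ℕ) : ℝ) ≤ ((N + 1 : ℕ) : ℝ) := by exact_mod_cast i.1.2.le
      linarith
    have h2 : m ^ (-a) * mass N i.1 ^ a ≤ m ^ (-a) * m ^ a :=
      mul_le_mul_of_nonneg_left h1 (by positivity)
    rw [← Real.rpow_add hm, neg_add_cancel, Real.rpow_zero] at h2
    linarith
  set V : ℝ := 16 * K * Λ * m ^ (-a) * H / L N with hVdef
  have hV0 : 0 ≤ V := by positivity
  have hV : ∑ x : OuterPart n L N, deviation F N x ^ 2
      ≤ Fintype.card (OuterPart n L N) * V := by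
    refine (sum_sq_deviation_le hn hF hH hc).trans (mul_le_mul_of_nonneg_left ?_ (by positivity))
    have h1 := (sum_linkCoeff_mul_groupMean_le ha1 hn hn1 hn2 hL hF).trans
      (mul_le_mul_of_nonneg_left hcomp (by positivity))
    refine (mul_le_mul_of_nonneg_left h1 (by positivity)).trans_eq ?_
    rw [hVdef]
    ring
  have hdev : ∀ z, deviationComp F N z ≤ ENNReal.ofReal H := by
    intro z
    unfold deviationComp
    refine indicator_apply_le' (fun hz => ?_) fun _ => zero_le
    have hz' : comp z = N := hz
    rcases cases z with ⟨M, y, rfl⟩ | ⟨M, x, rfl⟩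
    · exact zero_le
    · obtain rfl : M = N := hz'
      exact ENNReal.ofReal_le_ofReal (abs_deviation_le hn hL hF hH x)
  refine (lorentzOne_le_of_measure_le hp0 hs0.le hs hsp hm.le hV0 hH0
    (fun t ht => (vol_deviationComp_le hn F ht hV).1)
    (fun t ht => (vol_deviationComp_le hn F ht hV).2) hdev).trans ?_
  refine ENNReal.ofReal_le_ofReal (le_of_eq ?_)
  unfold deviationRate
  rw [mul_div_assoc']
  congr 1
  rcases hΛ.eq_or_lt with rfl | hΛ0
  · simp [hVdef, Real.zero_rpow hs0.ne']
  have hHpos : 0 < H := by positivity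
  have e1 : V ^ s = (16 * K) ^ s * Λ ^ s * m ^ (-a * s) * H ^ s * (L N : ℝ) ^ (-s) := by
    rw [hVdef, Real.div_rpow (by positivity) hL'.le, Real.mul_rpow (by positivity) hH0,
      Real.mul_rpow (by positivity) (by positivity), Real.mul_rpow (by positivity) hΛ,
      ← Real.rpow_mul hm.le, Real.rpow_neg hL'.le]
    ring
  have e2 : H ^ s * H ^ (1 - 2 * s) = H ^ (1 - s) := by
    rw [← Real.rpow_add hHpos]
    congr 1
    ring
  have e3 : H ^ (1 - s) = Λ ^ (1 - s) * m ^ (-a * (1 - s)) * (L N : ℝ) ^ (a * (1 - s))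
      * ((4 : ℝ) ^ (N + 1)) ^ (a * (1 - s)) := by
    rw [hHdef, Real.mul_rpow (by positivity) (by positivity), Real.mul_rpow hΛ (by positivity),
      ← Real.rpow_mul hm.le, ← Real.rpow_mul (by positivity), Real.mul_rpow hL'.le (by positivity)]
    ring
  have e4 : m ^ a * (m ^ (-a * s) * m ^ (-a * (1 - s))) = 1 := by
    rw [← Real.rpow_add hm, ← Real.rpow_add hm,
      show a + (-a * s + -a * (1 - s)) = 0 by ring, Real.rpow_zero]
  have e5 : Λ ^ s * Λ ^ (1 - s) = Λ := by
    rw [← Real.rpow_add hΛ0]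
    simp
  have e6 : (L N : ℝ) ^ (a * (1 - s) - s) = (L N : ℝ) ^ (a * (1 - s)) * (L N : ℝ) ^ (-s) := by
    rw [← Real.rpow_add hL']
    rfl
  -- By homogeneity the powers of m cancel and those of Λ add up to 1.
  calc m ^ a * V ^ s * H ^ (1 - 2 * s)
      = (16 * K) ^ s * Λ ^ s * m ^ a * m ^ (-a * s) * (H ^ s * H ^ (1 - 2 * s))
        * (L N : ℝ) ^ (-s) := by rw [e1]; ring
    _ = (16 * K) ^ s * (Λ ^ s * Λ ^ (1 - s)) * (m ^ a * (m ^ (-a * s) * m ^ (-a * (1 - s))))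
        * ((4 : ℝ) ^ (N + 1)) ^ (a * (1 - s))
        * ((L N : ℝ) ^ (a * (1 - s)) * (L N : ℝ) ^ (-s)) := by rw [e2, e3]; ring
    _ = _ := by rw [e4, e5, e6]; ring

end TestSpace

end Bounded

/-! ### Boundedness on L^{p,1}. -/

section BoundedOperator

variable {n L : ℕ → ℕ}

namespace TestSpace

theorem lintegral_dualWeight_mul_eq_tsum (a : ℝ) {F : TestSpace n L → ℝ} (hF : ∀ z, 0 ≤ F z) :
    ∫⁻ z, ENNReal.ofReal (dualWeight a z) * ENNReal.ofReal (F z) ∂vol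
      = ∑' N, ENNReal.ofReal (compSum N fun z : TestSpace n L => dualWeight a z * F z) := by
  rw [lintegral_vol_eq_tsum]
  refine tsum_congr fun N => ?_
  rw [← setLIntegral_comp N fun z => mul_nonneg (dualWeight_nonneg a z) (hF z)]
  simp only [ENNReal.ofReal_mul (dualWeight_nonneg a _)]

/-- The function is constant on each component, whose measure is at most 2m, so m^(-a) cancels. The
constant is 4 · 2^a ≤ 8. -/
theorem lorentzOne_componentwise_le {p : ℝ} (hp : 1 < p) (hn : ∀ l, 0 < n l)
    (hL : ∀ N, 0 < L N) {F : TestSpace n L → ℝ} (hF : ∀ z, 0 ≤ F z) :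
    lorentzOne p vol (fun z : TestSpace n L => ENNReal.ofReal
        (4 * mass (comp z) (comp z + 1) ^ (-(1 / p))
          * compSum (comp z) fun z => dualWeight (1 / p) z * F z))
      ≤ 8 * ∫⁻ z, ENNReal.ofReal (dualWeight (1 / p) z) * ENNReal.ofReal (F z) ∂vol := by
  have hp0 : 0 < p := by linarith
  set a := 1 / p with ha
  have ha0 : 0 < a := by positivity
  have ha1 : a < 1 := by rw [ha, div_lt_one hp0]; exact hp
  have hI : ∀ N, 0 ≤ compSum N fun z : TestSpace n L => dualWeight a z * F z := fun N =>
    compSum_nonneg N fun z => mul_nonneg (dualWeight_nonneg a z) (hF z)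
  refine (lorentzOne_le_tsum hp.le vol (h := fun N => {z | comp z = N}.indicator fun _ =>
    ENNReal.ofReal (4 * mass N (N + 1) ^ (-a) * compSum N fun z => dualWeight a z * F z))
    fun z => ⟨comp z, ?_⟩).trans ?_
  · rw [indicator_of_mem (by exact rfl)]
  rw [lintegral_dualWeight_mul_eq_tsum a hF, ← ENNReal.tsum_mul_left]
  refine ENNReal.tsum_le_tsum fun N => ?_
  have hm := mass_pos N (N + 1)
  rw [lorentzOne_indicator_const hp0 _ _ ENNReal.ofReal_ne_top]
  refine (mul_le_mul_right (ENNReal.rpow_le_rpow (vol_comp_le hn (hL N)) (by positivity)) _).trans ?_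
  rw [ENNReal.ofReal_rpow_of_nonneg (by positivity) (by positivity), ← ENNReal.ofReal_mul
    (mul_nonneg (by positivity) (hI N)), show (8 : ℝ≥0∞) = ENNReal.ofReal 8 by simp,
    ← ENNReal.ofReal_mul (by norm_num)]
  refine ENNReal.ofReal_le_ofReal ?_
  rw [← ha, Real.mul_rpow (by norm_num) hm.le]
  have e : mass N (N + 1) ^ (-a) * mass N (N + 1) ^ a = 1 := by
    rw [← Real.rpow_add hm, neg_add_cancel, Real.rpow_zero]
  have h2 : (2 : ℝ) ^ a ≤ 2 := by
    conv_rhs => rw [← Real.rpow_one 2]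
    exact Real.rpow_le_rpow_of_exponent_le (by norm_num) ha1.le
  calc 4 * mass N (N + 1) ^ (-a) * (compSum N fun z => dualWeight a z * F z)
        * ((2 : ℝ) ^ a * mass N (N + 1) ^ a)
      = 4 * (2 : ℝ) ^ a * (mass N (N + 1) ^ (-a) * mass N (N + 1) ^ a)
        * compSum N fun z => dualWeight a z * F z := by ring
    _ ≤ _ := by
        rw [e]
        nlinarith [hI N]

theorem exists_lorentzOne_centeredMaximal_le {p : ℝ} (hp : 1 < p) (hn : ∀ l, 0 < n l)
    (hn1 : ∀ l : ℕ, (2 : ℝ) ^ ((l : ℝ) * (1 - 1 / p)) ≤ n l)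
    (hn2 : ∀ l : ℕ, (n l : ℝ) ≤ 2 * (2 : ℝ) ^ ((l : ℝ) * (1 - 1 / p))) :
    ∃ L : ℕ → ℕ, (∀ N, 0 < L N) ∧ ∃ C : ℝ≥0∞, C ≠ ∞ ∧ ∀ f : TestSpace n L → ℂ,
      lorentzOne p vol (fun z => ENNReal.ofReal ‖f z‖) < ∞ →
      lorentzOne p vol (centeredMaximal vol f)
        ≤ C * lorentzOne p vol (fun z => ENNReal.ofReal ‖f z‖) := by
  have hp0 : 0 < p := by linarith
  have ha0 : 0 < 1 / p := by positivity
  have ha1 : 1 / p < 1 := by rw [div_lt_one hp0]; exact hp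
  obtain ⟨K, hK, hKle⟩ := exists_tsum_rpow_mul_min_le ha0 ha1
  -- The lower bound is equivalent to (1/p)(1 - s) < s, the decay condition on the deviation. The
  -- interval is nonempty because p > 1.
  obtain ⟨s, hs1, hs2⟩ : ∃ s, 1 / (p + 1) < s ∧ s < min (1 / 2) (1 / p) := by
    refine exists_between (lt_min ?_ ?_)
    · exact one_div_lt_one_div_of_lt two_pos (by linarith)
    · exact one_div_lt_one_div_of_lt hp0 (by linarith)
  have hs0 : 0 < s := lt_trans (by positivity) hs1
  have has : 1 / p * (1 - s) < s := by
    rw [div_lt_iff₀ (by positivity)] at hs1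
    rw [one_div_mul_eq_div, div_lt_iff₀ hp0]
    linarith
  choose L hL hrate using fun N => exists_deviationRate_le (K := K.toReal) has N
  refine ⟨L, hL, ?_⟩
  set U := vol (univ : Set (TestSpace n L)) with hU
  have hUtop : U ≠ ∞ := (vol_univ_lt_top hn hL).ne
  have hU0 : U ≠ 0 := by
    have hz : 0 < vol {outer (n := n) (L := L) 0 fun i => ⟨0, hn i.1⟩} := by
      rw [vol_singleton]
      simpa using weight_pos hn hL _
    exact (hz.trans_le (measure_mono (subset_univ _))).ne'
  -- The nested factors 2 come from three uses of the quasi-triangle inequality on the four summands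
  -- of the pointwise bound.
  refine ⟨2 * (1 + 2 * (K / U * U ^ (1 / p) + 2 * (8 * K + 2))), ?_, fun f hfin => ?_⟩
  · have h1 : K / U * U ^ (1 / p) ≠ ∞ := ENNReal.mul_ne_top (ENNReal.div_ne_top hK hU0)
      (ENNReal.rpow_ne_top_of_nonneg ha0.le hUtop)
    have h2 : 8 * K + 2 ≠ ∞ := by
      simp [ENNReal.mul_eq_top, hK]
    generalize K / U * U ^ (1 / p) = D at h1 ⊢
    simp [ENNReal.mul_eq_top, h1, h2]
  set F : TestSpace n L → ℝ := fun z => ‖f z‖ with hFdef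
  have hF : ∀ z, 0 ≤ F z := fun z => norm_nonneg _
  set Λ := lorentzOne p vol (fun z => ENNReal.ofReal (F z)) with hΛ
  have hΛtop : Λ ≠ ∞ := hfin.ne
  have hpair : ∫⁻ z, ENNReal.ofReal (dualWeight (1 / p) z) * ENNReal.ofReal (F z) ∂vol ≤ K * Λ :=
    lintegral_mul_le_lorentzOne (by fun_prop) hK
      (fun A _ => setLIntegral_dualWeight_le hn hL hKle A) (by fun_prop) hF
  have hint : ∫⁻ z, ENNReal.ofReal (F z) ∂vol ≤ K * Λ := by
    refine le_trans (lintegral_mono fun z => ?_) hpair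
    refine le_mul_of_one_le_left zero_le ?_
    rw [← ENNReal.ofReal_one]
    exact ENNReal.ofReal_le_ofReal (one_le_dualWeight ha1 z)
  have hconst : lorentzOne p vol (fun _ : TestSpace n L => (∫⁻ z, ENNReal.ofReal (F z) ∂vol) / U)
      ≤ K / U * U ^ (1 / p) * Λ := by
    have hne : (∫⁻ z, ENNReal.ofReal (F z) ∂vol) / U ≠ ∞ :=
      ENNReal.div_ne_top (ne_top_of_le_ne_top (ENNReal.mul_ne_top hK hΛtop) hint) hU0
    have := lorentzOne_indicator_const hp0 vol (univ : Set (TestSpace n L)) hne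
    rw [indicator_univ] at this
    rw [this, mul_right_comm, div_eq_mul_inv K, mul_right_comm K]
    exact mul_le_mul_left (ENNReal.div_le_div_right hint _) _
  have hcomp : ∀ N, (compSum N fun z => dualWeight (1 / p) z * F z) ≤ K.toReal * Λ.toReal := by
    intro N
    rw [← ENNReal.toReal_mul, ← ENNReal.ofReal_le_iff_le_toReal (ENNReal.mul_ne_top hK hΛtop)]
    refine le_trans ?_ hpair
    rw [lintegral_dualWeight_mul_eq_tsum _ hF]
    exact ENNReal.le_tsum N
  have hatom : ∀ z, F z * weight z ^ (1 / p) ≤ Λ.toReal := by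
    intro z
    rw [← ENNReal.ofReal_le_iff_le_toReal hΛtop, ENNReal.ofReal_mul (hF z),
      ← ENNReal.ofReal_rpow_of_nonneg (weight_nonneg z) ha0.le, ← vol_singleton]
    refine mul_measure_rpow_le_lorentzOne hp0 vol fun w hw => ?_
    rw [mem_singleton_iff.1 hw]
  have hdev : lorentzOne p vol (deviationFun F) ≤ 2 * Λ := by
    refine (lorentzOne_le_tsum hp.le vol (h := deviationComp F) fun z => ⟨comp z, ?_⟩).trans ?_
    · unfold deviationComp
      rw [indicator_of_mem (by exact rfl)]
    calc ∑' N, lorentzOne p vol (deviationComp F N)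
        ≤ ∑' N : ℕ, Λ * 2⁻¹ ^ N := by
          refine ENNReal.tsum_le_tsum fun N => ?_
          refine (lorentzOne_deviationComp_le hp hs0 (hs2.trans_le (min_le_left _ _))
            (hs2.le.trans (min_le_right _ _)) hn hn1 hn2 (hL N) hF ENNReal.toReal_nonneg
            ENNReal.toReal_nonneg hatom (hcomp N)).trans ?_
          rw [ENNReal.ofReal_mul ENNReal.toReal_nonneg, ENNReal.ofReal_toReal hΛtop]
          refine mul_le_mul_right ((ENNReal.ofReal_le_ofReal (hrate N)).trans_eq ?_) _
          rw [ENNReal.ofReal_pow (by norm_num), one_div, ENNReal.ofReal_inv_of_pos two_pos]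
          simp
      _ = 2 * Λ := by
          rw [ENNReal.tsum_mul_left, ENNReal.tsum_geometric, ENNReal.one_sub_inv_two, inv_inv,
            mul_comm]
  calc lorentzOne p vol (centeredMaximal vol f)
      ≤ lorentzOne p vol (fun z => ENNReal.ofReal (F z)
        + ((∫⁻ z, ENNReal.ofReal (F z) ∂vol) / U
        + (ENNReal.ofReal (4 * mass (comp z) (comp z + 1) ^ (-(1 / p))
          * compSum (comp z) fun z => dualWeight (1 / p) z * F z) + deviationFun F z))) :=
        lorentzOne_mono hp0 (centeredMaximal_le ha1 hn hn1 hn2 hL f)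
    _ ≤ 2 * (Λ + 2 * (K / U * U ^ (1 / p) * Λ + 2 * (8 * (K * Λ) + 2 * Λ))) := by
        refine (lorentzOne_add_le hp.le _ _ _).trans (mul_le_mul_right (add_le_add le_rfl ?_) _)
        refine (lorentzOne_add_le hp.le _ _ _).trans (mul_le_mul_right (add_le_add hconst ?_) _)
        refine (lorentzOne_add_le hp.le _ _ _).trans (mul_le_mul_right (add_le_add ?_ hdev) _)
        exact (lorentzOne_componentwise_le hp hn hL hF).trans (mul_le_mul_right hpair _)
    _ = _ := by ring

end TestSpace

end BoundedOperator

/-! ### Failure for q > 1, and failure of doubling. -/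

section Unbounded

theorem sum_range_two_pow_ite_le {u : ℝ} (hu : 0 ≤ u) (K : ℕ) :
    ∑ l ∈ Finset.range K, (if (2 : ℝ) ^ l < u then (2 : ℝ) ^ l else 0) ≤ 2 * u := by
  induction K with
  | zero => simpa using hu
  | succ K ih =>
    by_cases h : (2 : ℝ) ^ K < u
    · calc ∑ l ∈ Finset.range (K + 1), (if (2 : ℝ) ^ l < u then (2 : ℝ) ^ l else 0)
          ≤ ∑ l ∈ Finset.range (K + 1), (2 : ℝ) ^ l :=
            Finset.sum_le_sum fun l _ => by
              split_ifs
              · exact le_rfl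
              · positivity
        _ ≤ 2 * u := by
            rw [geom_sum_eq (by norm_num), pow_succ]
            linarith
    · rw [Finset.sum_range_succ, if_neg h, add_zero]
      exact ih

/-- The integral over t < 1 costs A^q, the range [1, T] costs A^q ∫ dt/t, and there is nothing above
T. The logarithm is the source of the growth N^(1/q). -/
theorem lorentzNorm_le_of_distribFun_le {X ε : Type*} [MeasurableSpace X] [ENorm ε] {p : ℝ}
    {q : ℝ≥0∞} (hp : 1 ≤ p) (hq : 1 ≤ q) {μ : Measure X} {f : X → ε} {A : ℝ≥0∞} (hA : A ≠ ∞) {T : ℝ}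
    (hT : 1 ≤ T) (h1 : ∀ t, 0 < t → distribFun μ f t ^ (1 / p) ≤ A)
    (h2 : ∀ t, 0 < t → ENNReal.ofReal t * distribFun μ f t ^ (1 / p) ≤ A)
    (h3 : ∀ x, ‖f x‖ₑ ≤ ENNReal.ofReal T) :
    lorentzNorm p q μ f ≤ ENNReal.ofReal p ^ (1 / q.toReal) * A
      * ENNReal.ofReal (1 + Real.log T) ^ (1 / q.toReal) := by
  have hp0 : 0 < p := by linarith
  have hlog := Real.log_nonneg hT
  unfold lorentzNorm
  split_ifs with h
  -- For q = ∞ the conventions `toReal ∞ = 0` and 1/0 = 0 turn the exponent into 0, so both extra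
  -- factors are 1.
  · simp only [h, ENNReal.toReal_top, div_zero, ENNReal.rpow_zero, one_mul, mul_one]
    exact iSup₂_le h2
  have hq1 : 1 ≤ q.toReal := by simpa using ENNReal.toReal_mono h hq
  have hq0 : 0 < q.toReal := by linarith
  rw [mul_assoc]
  refine mul_le_mul_right ?_ _
  rw [one_div q.toReal, ENNReal.rpow_inv_le_iff hq0, ENNReal.mul_rpow_of_nonneg _ _ hq0.le,
    ENNReal.rpow_inv_rpow hq0.ne']
  have hAq : A ^ q.toReal ≠ ∞ := ENNReal.rpow_ne_top_of_nonneg hq0.le hA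
  have hsplit : Ioi (0 : ℝ) = Ioo 0 1 ∪ (Icc 1 T ∪ Ioi T) := by
    ext t
    simp only [mem_Ioi, mem_union, mem_Ioo, mem_Icc]
    constructor
    · intro ht
      by_cases h4 : t < 1
      · exact Or.inl ⟨ht, h4⟩
      · by_cases h5 : t ≤ T
        · exact Or.inr (Or.inl ⟨not_lt.1 h4, h5⟩)
        · exact Or.inr (Or.inr (not_le.1 h5))
    · rintro (h4 | h4 | h4)
      · exact h4.1
      · linarith [h4.1]
      · linarith
  rw [hsplit]
  refine (lintegral_union_le _ _ _).trans ?_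
  rw [ENNReal.ofReal_add zero_le_one hlog, mul_add, ENNReal.ofReal_one]
  refine add_le_add ?_ ((lintegral_union_le _ _ _).trans ?_)
  · calc ∫⁻ t in Ioo (0 : ℝ) 1, (ENNReal.ofReal t * distribFun μ f t ^ (1 / p)) ^ q.toReal
          / ENNReal.ofReal t
        ≤ ∫⁻ _ in Ioo (0 : ℝ) 1, A ^ q.toReal := by
          refine setLIntegral_mono' measurableSet_Ioo fun t ht => ?_
          have ht1 : ENNReal.ofReal t ≤ 1 := by
            rw [← ENNReal.ofReal_one]; exact ENNReal.ofReal_le_ofReal ht.2.le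
          refine ENNReal.div_le_of_le_mul ?_
          rw [ENNReal.mul_rpow_of_nonneg _ _ hq0.le, mul_comm]
          refine mul_le_mul' (ENNReal.rpow_le_rpow (h1 t ht.1) hq0.le) ?_
          conv_rhs => rw [← ENNReal.rpow_one (ENNReal.ofReal t)]
          exact ENNReal.rpow_le_rpow_of_exponent_ge ht1 hq1
      _ = A ^ q.toReal * 1 := by
          rw [setLIntegral_const, Real.volume_Ioo]
          simp
  · have hzero : ∫⁻ t in Ioi T, (ENNReal.ofReal t * distribFun μ f t ^ (1 / p)) ^ q.toReal
          / ENNReal.ofReal t = 0 := by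
      refine (setLIntegral_congr_fun measurableSet_Ioi fun t ht => ?_).trans lintegral_zero
      have h4 : {x | ENNReal.ofReal t < ‖f x‖ₑ} = ∅ := by
        ext x
        simp only [mem_ofPred_eq, mem_empty_iff_false, iff_false, not_lt]
        have ht' : T < t := ht
        exact (h3 x).trans (ENNReal.ofReal_le_ofReal ht'.le)
      unfold distribFun
      rw [h4, measure_empty, ENNReal.zero_rpow_of_pos (by positivity), mul_zero,
        ENNReal.zero_rpow_of_pos hq0, ENNReal.zero_div]
    rw [hzero, add_zero]
    calc ∫⁻ t in Icc 1 T, (ENNReal.ofReal t * distribFun μ f t ^ (1 / p)) ^ q.toReal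
          / ENNReal.ofReal t
        ≤ ∫⁻ t in Icc 1 T, A ^ q.toReal * ENNReal.ofReal (1 / t) := by
          refine setLIntegral_mono' measurableSet_Icc fun t ht => ?_
          have ht0 : 0 < t := by linarith [ht.1]
          rw [div_eq_mul_inv, one_div t, ENNReal.ofReal_inv_of_pos ht0]
          exact mul_le_mul_left (ENNReal.rpow_le_rpow (h2 t ht0) hq0.le) _
      _ = A ^ q.toReal * ENNReal.ofReal (Real.log T) := by
          have hint : IntegrableOn (fun t : ℝ => 1 / t) (Icc 1 T) := by
            refine ContinuousOn.integrableOn_Icc (continuousOn_const.div continuousOn_id ?_)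
            exact fun t ht => (zero_lt_one.trans_le ht.1).ne'
          rw [lintegral_const_mul' _ _ hAq, ← ofReal_integral_eq_lintegral_ofReal hint
            ((ae_restrict_iff' measurableSet_Icc).2 (ae_of_all _ fun t ht => by
              have h5 : 0 ≤ t := by linarith [ht.1]
              positivity))]
          rw [integral_Icc_eq_integral_Ioc, ← intervalIntegral.integral_of_le hT,
            integral_one_div_of_pos one_pos (by linarith), div_one]

variable {n L : ℕ → ℕ}

namespace TestSpace

/-- The power of the shell masses on the inner part of the component `N`. -/
noncomputable def testFun (a : ℝ) (N : ℕ) : TestSpace n L → ℝ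
  | ⟨M, Sum.inl y⟩ => if M = N then (2 : ℝ) ^ ((((N + 1 : ℕ) : ℝ) - (y.1.1 : ℕ)) * a) else 0
  | ⟨_, Sum.inr _⟩ => 0

theorem testFun_inner (a : ℝ) (N : ℕ) (y : InnerPart n L N) :
    testFun a N (inner N y) = (2 : ℝ) ^ ((((N + 1 : ℕ) : ℝ) - (y.1.1 : ℕ)) * a) := if_pos rfl

theorem testFun_outer (a : ℝ) (N M : ℕ) (x : OuterPart n L M) : testFun a N (outer M x) = 0 := rfl

theorem testFun_of_comp_ne {a : ℝ} {N : ℕ} {z : TestSpace n L} (h : comp z ≠ N) :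
    testFun a N z = 0 := by
  rcases cases z with ⟨M, y, rfl⟩ | ⟨M, x, rfl⟩
  · exact if_neg h
  · rfl

theorem testFun_nonneg (a : ℝ) (N : ℕ) (z : TestSpace n L) : 0 ≤ testFun a N z := by
  by_cases h : comp z = N
  · subst h
    rcases cases z with ⟨M, y, rfl⟩ | ⟨M, x, rfl⟩
    · exact (testFun_inner a M y).symm ▸ by positivity
    · exact le_rfl
  · rw [testFun_of_comp_ne h]

theorem testFun_le {a : ℝ} (ha : 0 < a) (N : ℕ) (z : TestSpace n L) :
    testFun a N z ≤ (2 : ℝ) ^ (((N + 1 : ℕ) : ℝ) * a) := by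
  by_cases h : comp z = N
  · subst h
    rcases cases z with ⟨M, y, rfl⟩ | ⟨M, x, rfl⟩
    · refine (testFun_inner a M y).trans_le (Real.rpow_le_rpow_of_exponent_le (by norm_num) ?_)
      refine mul_le_mul_of_nonneg_right ?_ ha.le
      exact sub_le_self _ (Nat.cast_nonneg _)
    · rw [testFun_outer]
      positivity
  · rw [testFun_of_comp_ne h]
    positivity

/-- A superlevel set is the union of the shells with 2^l < 2^(N+1) t^(-p), and a sum of powers of
two is controlled by the largest. -/
theorem vol_testFun_superlevel_le {p : ℝ} (hp : 1 < p) (hn : ∀ l, 0 < n l) {N : ℕ} (hL : 0 < L N)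
    {t : ℝ} (ht : 0 < t) :
    vol {z : TestSpace n L | t < testFun (1 / p) N z} ≤ ENNReal.ofReal (mass N (N + 1)) ∧
    vol {z : TestSpace n L | t < testFun (1 / p) N z}
      ≤ ENNReal.ofReal (2 * mass N (N + 1) * t ^ (-p)) := by
  have hp0 : 0 < p := by linarith
  set A := {z : TestSpace n L | t < testFun (1 / p) N z} with hA
  have hAN : ∀ z ∈ A, comp z = N := by
    intro z hz
    by_contra h
    rw [hA, mem_ofPred_eq, testFun_of_comp_ne h] at hz
    linarith
  have hkey : vol A ≤ ENNReal.ofReal (∑ l ∈ Finset.range (N + 1), mass N l *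
      if (2 : ℝ) ^ l < 2 ^ (N + 1) * t ^ (-p) then 1 else 0) := by
    rw [← setLIntegral_one, setLIntegral_vol_of_subset_comp hAN]
    have h2 : ∀ x : OuterPart n L N, A.indicator (fun _ => (1 : ℝ≥0∞)) (outer N x) = 0 := fun x =>
      indicator_of_notMem (fun h => by
        rw [hA, mem_ofPred_eq, testFun_outer] at h
        linarith) _
    simp only [h2, mul_zero, Finset.sum_const_zero, add_zero]
    rw [← sum_weight_inner_shell hn hL fun l => if (2 : ℝ) ^ l < 2 ^ (N + 1) * t ^ (-p) then 1 else 0,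
      ENNReal.ofReal_sum_of_nonneg fun y _ => mul_nonneg (weight_nonneg _)
        (by split_ifs <;> norm_num)]
    refine Finset.sum_le_sum fun y _ => ?_
    rw [ENNReal.ofReal_mul (weight_nonneg _)]
    refine mul_le_mul_right ?_ _
    refine indicator_apply_le' (fun hy => ?_) fun _ => zero_le
    rw [if_pos, ENNReal.ofReal_one]
    rw [hA, mem_ofPred_eq, testFun_inner] at hy
    have h3 := Real.rpow_lt_rpow ht.le hy hp0
    rw [← Real.rpow_mul (by norm_num), mul_assoc, one_div_mul_cancel hp0.ne', mul_one,
      Real.rpow_sub two_pos, Real.rpow_natCast, Real.rpow_natCast, lt_div_iff₀ (by positivity)] at h3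
    rw [Real.rpow_neg ht.le, ← div_eq_mul_inv, lt_div_iff₀ (by positivity)]
    linarith
  refine ⟨hkey.trans (ENNReal.ofReal_le_ofReal ?_), hkey.trans (ENNReal.ofReal_le_ofReal ?_)⟩
  · refine le_trans (Finset.sum_le_sum fun l _ => ?_) (sum_range_mass_le N (N + 1))
    have := mass_pos N l
    split_ifs
    · rw [mul_one]
    · rw [mul_zero]; exact this.le
  · have hmass : ∀ l, mass N l = (2 : ℝ) ^ (-((N : ℝ) + 2) ^ 2) * 2 ^ l := fun l => by
      unfold mass
      rw [sub_eq_neg_add, Real.rpow_add two_pos, Real.rpow_natCast]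
    have h3 := sum_range_two_pow_ite_le (u := 2 ^ (N + 1) * t ^ (-p)) (by positivity) (N + 1)
    have h4 := mul_le_mul_of_nonneg_left h3
      (by positivity : (0 : ℝ) ≤ (2 : ℝ) ^ (-((N : ℝ) + 2) ^ 2))
    rw [Finset.mul_sum] at h4
    simp only [hmass, mul_assoc, mul_ite, mul_one, mul_zero] at h4 ⊢
    linarith

theorem lorentzNorm_testFun_le {p : ℝ} (hp : 1 < p) {q : ℝ≥0∞} (hq : 1 ≤ q) (hn : ∀ l, 0 < n l)
    {N : ℕ} (hL : 0 < L N) :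
    lorentzNorm p q vol (fun z : TestSpace n L => (testFun (1 / p) N z : ℂ))
      ≤ ENNReal.ofReal p ^ (1 / q.toReal) * ENNReal.ofReal ((2 * mass N (N + 1)) ^ (1 / p))
      * ENNReal.ofReal (N + 2) ^ (1 / q.toReal) := by
  have hp0 : 0 < p := by linarith
  have ha0 : 0 < 1 / p := by positivity
  have ha1 : 1 / p < 1 := by rw [div_lt_one hp0]; exact hp
  have hm := mass_pos N (N + 1)
  have hnorm : ∀ z : TestSpace n L, ‖(testFun (1 / p) N z : ℂ)‖ₑ
      = ENNReal.ofReal (testFun (1 / p) N z) := fun z => by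
    rw [← ofReal_norm, Complex.norm_real, Real.norm_of_nonneg (testFun_nonneg _ _ _)]
  have hdist : ∀ t, 0 < t → distribFun vol (fun z : TestSpace n L => (testFun (1 / p) N z : ℂ)) t
      = vol {z : TestSpace n L | t < testFun (1 / p) N z} := by
    intro t ht
    unfold distribFun
    congr 1
    ext z
    rw [mem_ofPred_eq, mem_ofPred_eq, hnorm, ENNReal.ofReal_lt_ofReal_iff_of_nonneg ht.le]
  have hmain := lorentzNorm_le_of_distribFun_le hp.le hq (μ := vol)
    (f := fun z : TestSpace n L => (testFun (1 / p) N z : ℂ))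
    (A := ENNReal.ofReal ((2 * mass N (N + 1)) ^ (1 / p))) ENNReal.ofReal_ne_top
    (T := (2 : ℝ) ^ (((N + 1 : ℕ) : ℝ) * (1 / p)))
    (Real.one_le_rpow (by norm_num) (by positivity)) ?_ ?_ ?_
  · refine hmain.trans (mul_le_mul_right (ENNReal.rpow_le_rpow (ENNReal.ofReal_le_ofReal ?_)
      (by positivity)) _)
    rw [Real.log_rpow two_pos]
    have h1 : Real.log 2 ≤ 1 := by linarith [Real.log_two_lt_d9]
    have h2 := Real.log_nonneg (one_le_two : (1 : ℝ) ≤ 2)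
    have h3 : ((N + 1 : ℕ) : ℝ) * (1 / p) ≤ N + 1 := by
      push_cast
      nlinarith [(Nat.cast_nonneg N : (0 : ℝ) ≤ N)]
    have h4 : (0 : ℝ) ≤ ((N + 1 : ℕ) : ℝ) * (1 / p) := by positivity
    nlinarith
  · intro t ht
    rw [hdist t ht, ← ENNReal.ofReal_rpow_of_nonneg (by positivity) ha0.le]
    refine ENNReal.rpow_le_rpow ((vol_testFun_superlevel_le hp hn hL ht).1.trans
      (ENNReal.ofReal_le_ofReal (by linarith))) ha0.le
  · intro t ht
    rw [hdist t ht]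
    refine (mul_le_mul_right (ENNReal.rpow_le_rpow (vol_testFun_superlevel_le hp hn hL ht).2
      ha0.le) _).trans_eq ?_
    rw [ENNReal.ofReal_rpow_of_nonneg (by positivity) ha0.le, ← ENNReal.ofReal_mul ht.le,
      Real.mul_rpow (by positivity) (by positivity), ← Real.rpow_mul ht.le,
      show -p * (1 / p) = -1 by field_simp, Real.rpow_neg_one]
    congr 1
    field_simp
  · intro z
    rw [hnorm]
    exact ENNReal.ofReal_le_ofReal (testFun_le ha0 N z)

theorem totalLinkMass_le {a : ℝ} (ha0 : 0 < a)
    (hn1 : ∀ l : ℕ, (2 : ℝ) ^ ((l : ℝ) * (1 - a)) ≤ n l) {N : ℕ} (hL : 0 < L N) :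
    totalLinkMass n L N
      ≤ (2 : ℝ) ^ (((N + 1 : ℕ) : ℝ) * a - ((N : ℝ) + 2) ^ 2) / ((2 : ℝ) ^ a - 1) := by
  have h2a : 1 < (2 : ℝ) ^ a := Real.one_lt_rpow (by norm_num) ha0
  rw [totalLinkMass_eq hL]
  have e : ∀ l : ℕ, (2 : ℝ) ^ ((l : ℝ) * a - ((N : ℝ) + 2) ^ 2)
      = ((2 : ℝ) ^ a) ^ l * (2 : ℝ) ^ (-((N : ℝ) + 2) ^ 2) := fun l => by
    rw [sub_eq_add_neg, Real.rpow_add two_pos, mul_comm (l : ℝ), Real.rpow_mul (by norm_num),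
      Real.rpow_natCast]
  refine (Finset.sum_le_sum fun l _ => mass_div_le hn1 N l).trans ?_
  simp only [e, ← Finset.sum_mul]
  rw [geom_sum_eq h2a.ne', div_mul_eq_mul_div]
  refine div_le_div_of_nonneg_right (mul_le_mul_of_nonneg_right (by linarith) (by positivity))
    (by linarith)

/-- With at least N + 1 groups of at least two atoms there are at least 2^(N+1) outer points. The
centre of a linked ball therefore does not dominate its mass. -/
theorem weight_outer_le (hn : ∀ l, 2 ≤ n l) {N : ℕ} (hL : 0 < L N) (x : OuterPart n L N) :
    weight (outer N x) ≤ (2 : ℝ) ^ (-((N : ℝ) + 2) ^ 2) := by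
  have hcard : 2 ^ (N + 1) ≤ Fintype.card (OuterPart n L N) := by
    rw [Fintype.card_pi]
    simp only [Fintype.card_fin]
    calc 2 ^ (N + 1) ≤ 2 ^ (Fintype.card (GroupIndex L N)) := by
          refine Nat.pow_le_pow_right (by norm_num) ?_
          simp only [Fintype.card_prod, Fintype.card_fin]
          exact Nat.le_mul_of_pos_right _ hL
      _ ≤ _ := Finset.pow_card_le_prod _ _ _ fun i _ => hn _
  have hcard' : (2 : ℝ) ^ (N + 1) ≤ Fintype.card (OuterPart n L N) := by exact_mod_cast hcard
  have h0 : (0 : ℝ) < (2 : ℝ) ^ (N + 1) := by positivity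
  rw [weight_outer, div_le_iff₀ (h0.trans_le hcard')]
  refine le_trans (le_of_eq ?_) (mul_le_mul_of_nonneg_left hcard' (by positivity))
  unfold mass
  rw [sub_eq_neg_add, Real.rpow_add two_pos, Real.rpow_natCast]

/-- In the linked ball the factor 2^(-la) of the test function cancels the chosen mass 2^(la), so
each of the N + 1 shells contributes at least E / 2. The measure of the ball is a geometric sum of
order E. -/
theorem le_centeredMaximal_testFun {a : ℝ} (ha0 : 0 < a) (hn : ∀ l, 2 ≤ n l)
    (hn1 : ∀ l : ℕ, (2 : ℝ) ^ ((l : ℝ) * (1 - a)) ≤ n l)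
    (hn2 : ∀ l : ℕ, (n l : ℝ) ≤ 2 * (2 : ℝ) ^ ((l : ℝ) * (1 - a))) {N : ℕ} (hL : 0 < L N)
    (x : OuterPart n L N) :
    ENNReal.ofReal (((N : ℝ) + 1) / (2 * (1 + 1 / ((2 : ℝ) ^ a - 1))))
      ≤ centeredMaximal vol (fun z : TestSpace n L => (testFun a N z : ℂ)) (outer N x) := by
  have hn0 : ∀ l, 0 < n l := fun l => two_pos.trans_le (hn l)
  have h2a : 1 < (2 : ℝ) ^ a := Real.one_lt_rpow (by norm_num) ha0
  have hpos : 0 < weight (outer N x) + totalLinkMass n L N :=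
    add_pos_of_nonneg_of_pos (weight_nonneg _) (totalLinkMass_pos hn0 hL)
  have hball : ball (outer N x) 2 = insert (outer N x) (range fun i => inner N ⟨i, x i⟩) :=
    ball_outer_eq (by norm_num) le_rfl
  have hnorm : ∀ z : TestSpace n L, ‖(testFun a N z : ℂ)‖ₑ = ENNReal.ofReal (testFun a N z) :=
    fun z => by
      rw [← ofReal_norm, Complex.norm_real, Real.norm_of_nonneg (testFun_nonneg _ _ _)]
  unfold centeredMaximal
  refine le_trans ?_ (le_iSup₂_of_le (2 : ℝ) ⟨two_pos, ?_, ?_⟩ le_rfl)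
  · simp only [hnorm]
    rw [hball, setLIntegral_insert_linked N x (testFun_nonneg a N), vol_insert_linked,
      ← ENNReal.ofReal_div_of_pos hpos]
    refine ENNReal.ofReal_le_ofReal ?_
    rw [testFun_outer, mul_zero, zero_add]
    simp only [testFun_inner]
    rw [sum_linkMass_mul hL fun l => (2 : ℝ) ^ ((((N + 1 : ℕ) : ℝ) - l) * a)]
    set E : ℝ := (2 : ℝ) ^ (((N + 1 : ℕ) : ℝ) * a - ((N : ℝ) + 2) ^ 2) with hE
    have hE0 : 0 < E := by positivity
    have hnum : ((N : ℝ) + 1) * (E / 2) ≤ ∑ l ∈ Finset.range (N + 1),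
        mass N l / n l * (2 : ℝ) ^ ((((N + 1 : ℕ) : ℝ) - l) * a) := by
      have h1 := Finset.card_nsmul_le_sum (Finset.range (N + 1))
        (fun l => mass N l / n l * (2 : ℝ) ^ ((((N + 1 : ℕ) : ℝ) - l) * a)) (E / 2) fun l _ => by
          refine le_trans (le_of_eq ?_)
            (mul_le_mul_of_nonneg_right (le_mass_div hn0 hn2 N l) (by positivity))
          rw [← Real.rpow_add two_pos, hE, ← Real.rpow_sub_one (by norm_num)]
          congr 1
          ring
      simpa [nsmul_eq_mul] using h1
    have hden : weight (outer N x) + totalLinkMass n L N ≤ E * (1 + 1 / ((2 : ℝ) ^ a - 1)) := by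
      have h1 : weight (outer N x) ≤ E := (weight_outer_le hn hL x).trans
        (Real.rpow_le_rpow_of_exponent_le (by norm_num) (by
          have : 0 ≤ ((N + 1 : ℕ) : ℝ) * a := by positivity
          linarith))
      have h2 := totalLinkMass_le ha0 hn1 hL
      rw [mul_add, mul_one, mul_one_div]
      exact add_le_add h1 h2
    refine le_trans (le_of_eq ?_) (div_le_div₀ (le_trans (by positivity) hnum) hnum hpos hden)
    have h3 : (1 : ℝ) + 1 / ((2 : ℝ) ^ a - 1) ≠ 0 := by
      have : 0 < 1 / ((2 : ℝ) ^ a - 1) := by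
        apply one_div_pos.2; linarith
      positivity
    field_simp
  · rw [hball, vol_insert_linked]
    simpa using hpos
  · rw [hball, vol_insert_linked]
    exact ENNReal.ofReal_ne_top

theorem not_lorentzMaximalBound {p : ℝ} (hp : 1 < p) {q r : ℝ≥0∞} (hq : 1 < q) (hr : 1 ≤ r)
    (hn : ∀ l, 2 ≤ n l)
    (hn1 : ∀ l : ℕ, (2 : ℝ) ^ ((l : ℝ) * (1 - 1 / p)) ≤ n l)
    (hn2 : ∀ l : ℕ, (n l : ℝ) ≤ 2 * (2 : ℝ) ^ ((l : ℝ) * (1 - 1 / p))) (hL : ∀ N, 0 < L N)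
    (C : ℝ≥0) : ¬ LorentzMaximalBound p q r (vol : Measure (TestSpace n L)) C := by
  intro hbound
  have hp0 : 0 < p := by linarith
  have ha0 : 0 < 1 / p := by positivity
  have hn0 : ∀ l, 0 < n l := fun l => two_pos.trans_le (hn l)
  set b := 1 / q.toReal with hb
  have hb0 : 0 ≤ b := by positivity
  have hb1 : b < 1 := by
    rcases eq_or_ne q ∞ with rfl | hqt
    · simp [hb]
    · have : 1 < q.toReal := by
        simpa using (ENNReal.toReal_lt_toReal ENNReal.one_ne_top hqt).2 hq
      rw [hb, div_lt_one (by linarith)]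
      exact this
  set c : ℝ := 1 / (2 * (1 + 1 / ((2 : ℝ) ^ (1 / p) - 1))) with hc
  have hc0 : 0 < c := by
    have h2a : 1 < (2 : ℝ) ^ (1 / p) := Real.one_lt_rpow (by norm_num) ha0
    have : 0 < 1 / ((2 : ℝ) ^ (1 / p) - 1) := by
      apply one_div_pos.2; linarith
    positivity
  have key : ∀ N : ℕ, ((N : ℝ) + 1) * c / 4
      ≤ C * p ^ b * (2 : ℝ) ^ (1 / p) * ((N : ℝ) + 2) ^ b := by
    intro N
    have hm := mass_pos N (N + 1)
    have h1 := lorentzNorm_testFun_le hp hq.le hn0 (hL N)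
    have h2 := hbound (fun z => (testFun (1 / p) N z : ℂ)) Measurable.of_discrete
      (h1.trans_lt (by
        rw [← hb]
        exact ENNReal.mul_lt_top (ENNReal.mul_lt_top
          (ENNReal.rpow_lt_top_of_nonneg hb0 ENNReal.ofReal_ne_top) ENNReal.ofReal_lt_top)
          (ENNReal.rpow_lt_top_of_nonneg hb0 ENNReal.ofReal_ne_top)))
    have h3 := le_lorentzNorm_of_le hp.le hr vol
      (f := centeredMaximal vol (fun z : TestSpace n L => (testFun (1 / p) N z : ℂ)))
      (E := range (outer N)) (c := ((N : ℝ) + 1) * c) (by positivity) (by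
        rintro _ ⟨x, rfl⟩
        have := le_centeredMaximal_testFun ha0 hn hn1 hn2 (hL N) x
        rw [hc, mul_one_div]
        exact this)
    rw [vol_range_outer hn0] at h3
    have h4 := h3.trans (h2.trans (mul_le_mul_right h1 _))
    rw [← hb, ENNReal.ofReal_rpow_of_nonneg hm.le ha0.le, ← ENNReal.ofReal_mul (by positivity),
      ENNReal.ofReal_rpow_of_nonneg hp0.le hb0, ENNReal.ofReal_rpow_of_nonneg (by positivity) hb0,
      ← ENNReal.ofReal_coe_nnreal, ← ENNReal.ofReal_mul (by positivity),
      ← ENNReal.ofReal_mul (by positivity), ← ENNReal.ofReal_mul (by positivity),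
      ENNReal.ofReal_le_ofReal_iff (by positivity), Real.mul_rpow two_pos.le hm.le] at h4
    have hma : 0 < mass N (N + 1) ^ (1 / p) := by positivity
    refine le_of_mul_le_mul_right (h4.trans_eq ?_) hma
    ring
  have hlim := (tendsto_rpow_neg_atTop (y := 1 - b) (by linarith)).comp
    ((tendsto_natCast_atTop_atTop (R := ℝ)).comp (Filter.tendsto_add_atTop_nat 2))
  have hlim2 := hlim.const_mul (C * p ^ b * (2 : ℝ) ^ (1 / p))
  rw [mul_zero] at hlim2
  -- The bound c/8 suffices because (N + 2)/8 ≤ (N + 1)/4 for every N ≥ 0.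
  obtain ⟨N, hN⟩ := (hlim2.eventually_lt_const (u := c / 8) (by positivity)).exists
  have h5 : (0 : ℝ) < (N : ℝ) + 2 := by positivity
  have h6 : ((N : ℝ) + 2) ^ b = ((N : ℝ) + 2) ^ (-(1 - b)) * ((N : ℝ) + 2) := by
    conv_rhs => rw [← Real.rpow_add_one h5.ne']
    congr 1
    ring
  have h7 := key N
  simp only [Function.comp_apply] at hN
  push_cast at hN
  rw [h6, ← mul_assoc] at h7
  have h8 := mul_lt_mul_of_pos_right hN h5
  have h9 : (0 : ℝ) ≤ N := Nat.cast_nonneg N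
  nlinarith

theorem not_isDoublingMeasure (hn : ∀ l, 0 < n l) (hL : ∀ N, 0 < L N) :
    ¬ IsDoublingMeasure (vol : Measure (TestSpace n L)) := by
  rintro ⟨C, hC⟩
  have h1 : ∀ N : ℕ, vol (univ : Set (TestSpace n L)) ≤ C * ENNReal.ofReal (2 * (1 / 2) ^ N) := by
    intro N
    -- The radius 8/5 stays inside the component, whose mass tends to 0, while 16/5 exceeds the
    -- diameter bound 3.
    have h2 := hC (outer N fun i => ⟨0, hn i.1⟩) (8 / 5) (by norm_num)
    rw [ball_eq_univ (by norm_num)] at h2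
    refine h2.trans (mul_le_mul_right ?_ _)
    refine (measure_mono (ball_subset_comp (by norm_num))).trans ((vol_comp_le hn (hL N)).trans
      (ENNReal.ofReal_le_ofReal ?_))
    refine mul_le_mul_of_nonneg_left ?_ two_pos.le
    unfold mass
    rw [one_div, inv_pow, ← Real.rpow_natCast 2 N, ← Real.rpow_neg two_pos.le]
    refine Real.rpow_le_rpow_of_exponent_le (by norm_num) ?_
    push_cast
    nlinarith [(Nat.cast_nonneg N : (0 : ℝ) ≤ N)]
  have hlim : Filter.Tendsto (fun N : ℕ => (C : ℝ≥0∞) * ENNReal.ofReal (2 * (1 / 2) ^ N))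
      Filter.atTop (nhds 0) := by
    have h3 := ENNReal.tendsto_ofReal ((tendsto_pow_atTop_nhds_zero_of_lt_one
      (by norm_num : (0 : ℝ) ≤ 1 / 2) (by norm_num)).const_mul 2)
    rw [mul_zero, ENNReal.ofReal_zero] at h3
    have h4 := ENNReal.Tendsto.const_mul (a := (C : ℝ≥0∞)) h3 (Or.inr ENNReal.coe_ne_top)
    rwa [mul_zero] at h4
  have h5 : vol (univ : Set (TestSpace n L)) ≤ 0 := ge_of_tendsto' hlim h1
  have h6 : vol {outer (n := n) (L := L) 0 fun i => ⟨0, hn i.1⟩} ≤ 0 :=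
    (measure_mono (subset_univ _)).trans h5
  rw [vol_singleton, nonpos_iff_eq_zero, ENNReal.ofReal_eq_zero] at h6
  exact absurd h6 (not_le.2 (weight_pos hn hL _))

end TestSpace

end Unbounded

/-! ### The theorem. -/

theorem theorem4p3p1 (p₀ : ℝ) (q₀ r₀ : ℝ≥0∞) (hadm : AdmissibleTriple p₀ q₀ r₀)
    (hq₀ : 1 < q₀) :
    ∃ (Z : Type) (_ : Nonempty Z) (_ : MetricSpace Z) (_ : MeasurableSpace Z)
      (_ : BorelSpace Z) (μ : Measure Z),
      Bornology.IsBounded (univ : Set Z) ∧ μ univ < ∞ ∧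
      (∀ (z : Z) (s : ℝ), 0 < s → 0 < μ (ball z s)) ∧
      ¬ IsDoublingMeasure μ ∧
      lorentzMaximalConst p₀ 1 r₀ μ < ∞ ∧
      lorentzMaximalConst p₀ q₀ r₀ μ = ∞ := by
  rcases hadm with ⟨-, hq1, -⟩ | ⟨hp, -, hr, -⟩
  · exact absurd hq1 hq₀.ne'
  have hp0 : 0 < p₀ := by linarith
  have ha1 : 1 / p₀ < 1 := by rw [div_lt_one hp0]; exact hp
  -- Adding 1 to the floor puts n l between the power and its double and gives n l ≥ 2, even for l =
  -- 0.
  set n : ℕ → ℕ := fun l => ⌊(2 : ℝ) ^ ((l : ℝ) * (1 - 1 / p₀))⌋₊ + 1 with hndef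
  have hbase : ∀ l : ℕ, 1 ≤ (2 : ℝ) ^ ((l : ℝ) * (1 - 1 / p₀)) := fun l =>
    Real.one_le_rpow (by norm_num) (mul_nonneg (Nat.cast_nonneg l) (by linarith))
  have hn1 : ∀ l : ℕ, (2 : ℝ) ^ ((l : ℝ) * (1 - 1 / p₀)) ≤ n l := fun l => by
    simp only [hndef]
    push_cast
    exact (Nat.lt_floor_add_one _).le
  have hn2 : ∀ l : ℕ, (n l : ℝ) ≤ 2 * (2 : ℝ) ^ ((l : ℝ) * (1 - 1 / p₀)) := fun l => by
    simp only [hndef]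
    push_cast
    have := Nat.floor_le (zero_le_one.trans (hbase l))
    linarith [hbase l]
  have hn : ∀ l, 2 ≤ n l := fun l => Nat.succ_le_succ (Nat.le_floor (by simpa using hbase l))
  have hn0 : ∀ l, 0 < n l := fun l => Nat.succ_pos _
  obtain ⟨L, hL, C, hC, hbound⟩ := TestSpace.exists_lorentzOne_centeredMaximal_le hp hn0 hn1 hn2
  refine ⟨TestSpace n L, ⟨TestSpace.outer 0 fun i => ⟨0, hn0 i.1⟩⟩, inferInstance, inferInstance,
    inferInstance, TestSpace.vol, TestSpace.isBounded_univ, TestSpace.vol_univ_lt_top hn0 hL, ?_,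
    TestSpace.not_isDoublingMeasure hn0 hL, ?_, ?_⟩
  · intro z s hs
    have h1 : 0 < TestSpace.vol {z} := by
      rw [TestSpace.vol_singleton]
      simpa using TestSpace.weight_pos hn0 hL z
    exact h1.trans_le (measure_mono (singleton_subset_iff.2 (mem_ball_self hs)))
  · refine lt_of_le_of_lt (iInf₂_le C.toNNReal ?_) ENNReal.coe_lt_top
    intro f _ hf
    have hp' : ENNReal.ofReal p₀ ≠ 0 := by simpa using hp0
    rw [lorentzNorm_one_eq] at hf ⊢
    simp only [← ofReal_norm] at hf ⊢
    have hf' := ENNReal.lt_top_of_mul_ne_top_right hf.ne hp'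
    refine (lorentzNorm_le_mul_lorentzOne hp.le hr _ _).trans ?_
    simp only [enorm_eq_self]
    rw [ENNReal.coe_toNNReal hC, mul_left_comm]
    exact mul_le_mul_right (hbound f hf') _
  · refine iInf₂_eq_top.2 fun C hC => ?_
    exact absurd hC (TestSpace.not_lorentzMaximalBound hp hq₀ hr hn hn1 hn2 hL C)
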